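/- Let $k$ be an algebraically closed field of characteristic $p>0$ and let $d\ge p$ be an integer. Let $$\Delta_X=\sigma(x_0,x_1)-x_2^p,\qquad \sigma(A,B)=\sum_{i=1}^{p-1}\sigma_iA^iB^{p-i},\qquad \sigma_i\in k,\quad \sigma_1=\sigma_{p-1}=1,$$ and let $\mathrm{str}=[0:0:1]\in\mathbb P^2$. Let $b_0,b_1,c_0,c_1$ be the coordinates of $\mathbb A^4$, put $L_j=c_jx_0-b_jx_1$ for $j=0,1$ and $\pi=b_1c_0-b_0c_1$, and for $a_1,\dots,a_{d-p-1}\in k$ (no choice if $d-p\le 1$) let $$\Psi=L_1^d-(-1)^d\pi^p\,\Delta_X\,\mathcal L,\qquad \mathcal L=\begin{cases}1,& d=p,\\ L_0\prod_{j=1}^{d-p-1}(L_0-a_j^pL_1),& d>p,\end{cases}$$ $$\mathcal C=(\Psi=0)\subset\mathbb P^2\times\mathbb A^4 .$$ For $w\in\mathbb A^4(k)$ let $\mathcal C_w\subset\mathbb P^2$ be the fiber of $\mathcal C$ over $w$. A cusp of a plane curve is a unibranch singular point, that is, a singular point at which the local equation is irreducible as a formal power series. An ordinary point of multiplicity $m$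 is a point at which the lowest-degree part of the local equation is, up to a nonzero constant, a product of $m$ pairwise non-proportional linear forms (for $m=0$: a point not on the curve; for $m=1$: a smooth point). "General" means: in some nonempty Zariski open subset of the parameter space. For every $\Delta_X$ as above, for a general choice of $a_1,\dots,a_{d-p-1}$ and for general $w\in\mathbb A^4$: - $\mathrm{str}$ is an ordinary point of $\mathcal C_w$ of multiplicity $d-p$, and every singular point of $\mathcal C_w$ other than $\mathrm{str}$ is a cusp; - (a) if $d-p=0$, the singular points of $\mathcal C$ lying on $\mathcal C_w$ are precisely the cusps of $\mathcal C_w$; - (b) if $d-p=1$, then $\mathcal C$ is smooth at every point of $\mathcal C_w$; - (c) if $d-p>1$, then $\mathcal C$ is smooth at every point of $\mathcal C_w\setminus\{\mathrm{str}\}$. Furthermore, for a general choice of $\Delta_X$ (that is, of $\sigma_2,\dots,\sigma_{p-2}$), of $a_1,\dots,a_{d-p-1}$ and of $w$ (that is, for all triples in a nonempty Zariski open subset of the product of the three parameter spaces): 1. if $p=2$, then $\mathcal C_w$ has exactly $d-2$ cusps; 2. if $p>2$, then $\mathcal C_w$ has exactly $2d-p-2$ cusps. -/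

import Mathlib

noncomputable section

namespace A1Curves

open MvPolynomial

variable {k : Type*} [Field k]

/-! ### General points -/

/-- `P x` holds for a general point `x` of the affine space with coordinates indexed by `ι`:
it holds on a nonempty Zariski open subset (over an infinite field, every nonempty open subset
contains a nonempty principal open subset `G ≠ 0`). -/
def ForGeneral {ι : Type*} (P : (ι → k) → Prop) : Prop :=
  ∃ G : MvPolynomial ι k, G ≠ 0 ∧ ∀ x : ι → k, eval x G ≠ 0 → P x

/-- `P s a w` holds for a general point `(s, a, w)` of a product of three affine spaces. -/
def ForGeneral₃ {ι κ τ : Type*} (P : (ι → k) → (κ → k) → (τ → k) → Prop) : Prop :=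
  ForGeneral fun v : ι ⊕ κ ⊕ τ → k =>
    P (fun i => v (.inl i)) (fun j => v (.inr (.inl j))) (fun l => v (.inr (.inr l)))

/-! ### Local geometry of hypersurfaces -/

/-- Jacobian criterion: `x` lies on the hypersurface `F = 0` and all partial derivatives of `F`
vanish at `x`.  For `F` homogeneous in a group of variables this is also, by Euler's formula, the
condition that the point with homogeneous coordinates `x` is a singular point of the hypersurface
in the corresponding projective (or product of projective and affine) space, and it does not
depend on the choice of homogeneous coordinates. -/
def IsSingularAt {ι : Type*} (F : MvPolynomial ι k) (x : ι → k) : Prop :=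
  eval x F = 0 ∧ ∀ i, eval x (pderiv i F) = 0

/-- The projective plane. -/
abbrev Plane (k : Type*) [Field k] : Type _ := Projectivization k (Fin 3 → k)

/-- The plane curve `F = 0` passes through `P`. -/
def OnCurve (F : MvPolynomial (Fin 3) k) (P : Plane k) : Prop := eval P.rep F = 0

/-- `P` is a singular point of the plane curve `F = 0`. -/
def IsSingularPoint (F : MvPolynomial (Fin 3) k) (P : Plane k) : Prop := IsSingularAt F P.rep

/-- The equation of the plane curve `F = 0` in the affine chart `x i ≠ 0`, whose coordinates are
the quotients of the two other homogeneous coordinates by the `i`-th one, translated so that the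
point with homogeneous coordinates `x` becomes the origin. -/
def localEq (F : MvPolynomial (Fin 3) k) (x : Fin 3 → k) (i : Fin 3) : MvPolynomial (Fin 2) k :=
  aeval (Fin.insertNth (α := fun _ => MvPolynomial (Fin 2) k) i 1
    (fun l : Fin 2 => X l + C (x (i.succAbove l) / x i))) F

/-- `P` is an ordinary point of multiplicity `m` of the plane curve `F = 0`: the lowest-degree
part of the local equation at `P` has degree `m` and is a product of `m` pairwise
non-proportional linear forms (`m` distinct tangent lines).  Multiplicity `0` means that `P` is
not on the curve, and multiplicity `1` that `P` is a smooth point of it. -/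
def IsOrdinaryPoint (F : MvPolynomial (Fin 3) k) (P : Plane k) (m : ℕ) : Prop :=
  ∃ i : Fin 3, P.rep i ≠ 0 ∧
    (∀ n < m, homogeneousComponent n (localEq F P.rep i) = 0) ∧
    ∃ (c : k) (u v : Fin m → k), c ≠ 0 ∧ (∀ j, u j ≠ 0 ∨ v j ≠ 0) ∧
      (∀ j j', j ≠ j' → u j * v j' ≠ u j' * v j) ∧
      homogeneousComponent m (localEq F P.rep i) =
        C c * ∏ j, (C (u j) * X 0 + C (v j) * X 1)

/-- `P` is a cusp of the plane curve `F = 0`: a unibranch singular point, that is, a singular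
point at which the local equation is irreducible as a formal power series (exactly one formal
branch, counted with multiplicity). -/
def IsCusp (F : MvPolynomial (Fin 3) k) (P : Plane k) : Prop :=
  IsSingularPoint F P ∧
    ∃ i : Fin 3, P.rep i ≠ 0 ∧
      Irreducible (localEq F P.rep i : MvPowerSeries (Fin 2) k)

/-- The point `[0 : 0 : 1]`. -/
def str : Plane k :=
  Projectivization.mk k ![0, 0, 1] (fun h => one_ne_zero (α := k) (by simpa using congrFun h 2))

/-! ### The boundary curve and the family -/

/-- The coefficients `σ 1, …, σ (p - 1)`: those with `1 < i < p - 1` are arbitrary, and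
`σ 1 = σ (p - 1) = 1`. -/
def sigmaCoeff (p : ℕ) (s : Finset.Ioo 1 (p - 1) → k) (i : ℕ) : k :=
  if h : i ∈ Finset.Ioo 1 (p - 1) then s ⟨i, h⟩ else 1

/-- The equation `σ(x₀, x₁) - x₂ ^ p` of the boundary curve. -/
def boundary (p : ℕ) (s : Finset.Ioo 1 (p - 1) → k) : MvPolynomial (Fin 3) k :=
  (∑ i ∈ Finset.Icc 1 (p - 1), C (sigmaCoeff p s i) * X 0 ^ i * X 1 ^ (p - i)) - X 2 ^ p

/-- Polynomials in the homogeneous coordinates `x₀, x₁, x₂` of the plane (left summand) and the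
coordinates `b₀, b₁, c₀, c₁` of affine four-space (right summand, in this order). -/
abbrev FamilyRing (k : Type*) [Field k] : Type _ := MvPolynomial (Fin 3 ⊕ Fin 4) k

/-- `L₀ = c₀ x₀ - b₀ x₁`. -/
def L₀ : FamilyRing k :=
  X (.inr 2) * X (.inl 0) - X (.inr 0) * X (.inl 1)

/-- `L₁ = c₁ x₀ - b₁ x₁`. -/
def L₁ : FamilyRing k :=
  X (.inr 3) * X (.inl 0) - X (.inr 1) * X (.inl 1)

/-- `π = b₁ c₀ - b₀ c₁`. -/
def disc : FamilyRing k :=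
  X (.inr 1) * X (.inr 2) - X (.inr 0) * X (.inr 3)

/-- The factor `1` if `d = p`, and `L₀ ∏ (L₀ - a_j ^ p L₁)`, over `1 ≤ j ≤ d - p - 1`,
if `d > p`. -/
def linePart (p d : ℕ) (a : Fin (d - p - 1) → k) : FamilyRing k :=
  if d - p = 0 then 1 else L₀ * ∏ j, (L₀ - C (a j ^ p) * L₁)

/-- The equation `Ψ` of the total space of the family in `ℙ² × 𝔸⁴`. -/
def totalEq (p d : ℕ) (s : Finset.Ioo 1 (p - 1) → k) (a : Fin (d - p - 1) → k) : FamilyRing k :=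
  L₁ ^ d - (-1) ^ d * disc ^ p * rename Sum.inl (boundary p s) * linePart p d a

/-- The equation of the fiber of the family over `w = (b₀, b₁, c₀, c₁)`. -/
def fiberEq (p d : ℕ) (s : Finset.Ioo 1 (p - 1) → k) (a : Fin (d - p - 1) → k) (w : Fin 4 → k) :
    MvPolynomial (Fin 3) k :=
  aeval (Sum.elim X fun l => C (w l)) (totalEq p d s a)

/-- The total space is smooth at the point `(P, w)` lying on it. -/
def TotalSmoothAt (p d : ℕ) (s : Finset.Ioo 1 (p - 1) → k) (a : Fin (d - p - 1) → k)
    (P : Plane k) (w : Fin 4 → k) : Prop :=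
  ¬ IsSingularAt (totalEq p d s a) (Sum.elim P.rep w)

end A1Curves

end

/-! Everything is seen from `str`, through the fact that `x₂` enters only via `x₂ ^ p`, which every
derivation kills. On a fiber write `F = V ^ d - c S M`, where `U`, `V` are the values of `L₀`, `L₁`,
`S` is that of the boundary equation, `M` is the product of the `d - p` lines, and `c = ± π ^ p ≠
0`. In characteristic `p`, `dσ = g (y dx - x dy)` for a binary form `g` of degree `p - 2`. Euler's
identity for `M`, with `d - p = d` in `k`, gives `lineVal_mul_derivation`: `M DF = R (y Dx - x Dy) +
F DM`, with `R = π V ^ (d - 1) M_U - c g M ^ 2`. Here `R` (`cuspForm`) is a binary form of degree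
`2d - p - 2`. A point of the curve other than `str` has `M ≠ 0`, so it is singular exactly when its
direction is a zero of `R`.

Unibranchness: in a chart the local equation is `β(t) z ^ p + φ(t)` with `β(0) ≠ 0`, and the
Wronskian of `φ` and `β` is, up to a nonzero constant, the dehomogenized `R`. If it is not
identically zero, a substitution `z ↦ z + χ(t)` gives `φ` an order `m` prime to `p`
(`exists_order_coprime`). The Newton polygon is then one segment without interior lattice points, so
the equation is irreducible (`irreducible_of_weight`). Since `R = -c g M ^ 2` where `V = 0`, it
suffices that `g` does not vanish there.

At `str` the local equation is `c M` plus a form of degree `d`, so the point is ordinary. For `d - p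
> 1` it is not a cusp, since one tangent line lifts to a smooth branch
(`not_irreducible_of_tangents`). For the total space, the derivatives in `b` and `c` separate the
coefficients of `dU` and `dV`; a singular point off `str` needs `g = 0` and `S M_U = 0`, which
general parameters exclude when `d > p`.

Counting: `p`-th roots are unique, so each zero of `R` carries exactly one cusp (`encard_isCusp`),
and the distinct zeros of `R` have to be counted. For `p > 2` they are generically simple. For `p =
2` the derivative of the dehomogenized `R` vanishes, so zeros are at least double, and generically
exactly double. Both are resultant conditions (`cuspDiscr`), hence open; one good member suffices.
It is found with `σ₂ = … = σ_{p-2} = 0`: for `d = p` directly, and for `d > p` by scaling `w`, which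
moves `R` in a pencil without base points (`exists_maximal_cusps`). -/

noncomputable section

namespace A1Curves

/-! ### Irreducible power series -/

section PowerSeriesIrreducible

open MvPowerSeries Finsupp

variable {k : Type*} [Field k]

/-- A power series in two variables whose Newton polygon is a segment without interior lattice
points is irreducible. -/
theorem irreducible_of_weight {p m : ℕ} (hp : 0 < p) (hm : 0 < m) (hpm : p.Coprime m)
    {G : MvPowerSeries (Fin 2) k} (h1 : coeff (single 1 p) G ≠ 0)
    (h2 : coeff (single 0 m) G ≠ 0)
    (h3 : ∀ d : Fin 2 →₀ ℕ, d 0 * p + d 1 * m < p * m → coeff d G = 0) : Irreducible G := by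
  have hw : ∀ d : Fin 2 →₀ ℕ, weight ![p, m] d = d 0 * p + d 1 * m := fun d => by
    simp [weight_apply, Finsupp.sum_fintype]
  have hpos : ∀ A : MvPowerSeries (Fin 2) k, ¬ IsUnit A → constantCoeff A = 0 := fun A hA => by
    rw [MvPowerSeries.isUnit_iff_constantCoeff, isUnit_iff_ne_zero, not_not] at hA
    exact hA
  refine ⟨fun hu => ?_, fun A B hAB => ?_⟩
  · rw [MvPowerSeries.isUnit_iff_constantCoeff, isUnit_iff_ne_zero,
      ← coeff_zero_eq_constantCoeff_apply] at hu
    exact hu (h3 0 (by simpa using ⟨hp, hm⟩))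
  · by_contra hcon
    push Not at hcon
    have hA := hpos A hcon.1
    have hB := hpos B hcon.2
    have hG : ((p * m : ℕ) : ℕ∞) ≤ G.weightedOrder ![p, m] :=
      nat_le_weightedOrder _ fun d hd => h3 d (by rwa [hw] at hd)
    have hsum := weightedOrder_mul ![p, m] A B
    rw [← hAB] at hsum
    -- The weighted orders of `A` and `B` add up to that of `G`, which is at least `p * m`.
    have key : ∀ d e : Fin 2 →₀ ℕ, coeff d A ≠ 0 → coeff e B ≠ 0 →
        p * m ≤ (d 0 * p + d 1 * m) + (e 0 * p + e 1 * m) := fun d e hd he => by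
      have h1 := weightedOrder_le ![p, m] hd
      have h2 := weightedOrder_le ![p, m] he
      rw [hw] at h1 h2
      have := (hG.trans hsum.le).trans (add_le_add h1 h2)
      exact_mod_cast this
    -- A pure power in `G` can only come from pure powers of the same variable in `A` and `B`.
    have ex : ∀ (i : Fin 2) (n : ℕ), coeff (single i n) G ≠ 0 →
        ∃ a b, a + b = n ∧ coeff (single i a) A ≠ 0 ∧ coeff (single i b) B ≠ 0 := by
      intro i n h
      rw [hAB, coeff_mul] at h
      obtain ⟨⟨u, v⟩, huv, hne⟩ := Finset.exists_ne_zero_of_sum_ne_zero h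
      rw [Finset.HasAntidiagonal.mem_antidiagonal] at huv
      have hz : ∀ j, j ≠ i → u j = 0 ∧ v j = 0 := fun j hj => by
        have := congrArg (fun f => f j) huv
        simp [hj.symm] at this
        exact this
      have hu : u = single i (u i) := by
        ext j; by_cases hj : j = i
        · subst hj; simp
        · simp [Ne.symm hj, (hz j hj).1]
      have hv : v = single i (v i) := by
        ext j; by_cases hj : j = i
        · subst hj; simp
        · simp [Ne.symm hj, (hz j hj).2]
      refine ⟨u i, v i, by simpa using congrArg (fun f => f i) huv, ?_, ?_⟩
      · rw [← hu]; exact left_ne_zero_of_mul hne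
      · rw [← hv]; exact right_ne_zero_of_mul hne
    obtain ⟨a, b, hab, ha, hb⟩ := ex 1 p h1
    obtain ⟨i, j, hij, hi, hj⟩ := ex 0 m h2
    have e1 := key _ _ ha hj
    have e2 := key _ _ hi hb
    simp at e1 e2
    -- The left sides of `e1` and `e2` add up to `(a + b) m + (i + j) p = 2 p m`, so both are
    -- equalities. Then `p ∣ a` with `0 < a < p`, which is absurd.
    have e3 : i * p = a * m := by nlinarith
    have ha0 : a ≠ 0 := by
      rintro rfl
      simp at ha
      exact ha hA
    have hb0 : b ≠ 0 := by
      rintro rfl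
      simp at hb
      exact hb hB
    have : p ∣ a := hpm.dvd_of_dvd_mul_right ⟨i, by rw [← e3]; ring⟩
    have := Nat.le_of_dvd (Nat.pos_of_ne_zero ha0) this
    omega

/-- Univariate polynomials as power series in the first of two variables. -/
def toFirst : Polynomial k →ₐ[k] MvPolynomial (Fin 2) k := Polynomial.aeval (MvPolynomial.X 0)

theorem coeff_toFirst (f : Polynomial k) (d : Fin 2 →₀ ℕ) :
    MvPolynomial.coeff d (toFirst f) = if d 1 = 0 then f.coeff (d 0) else 0 := by
  induction f using Polynomial.induction_on' with
  | add f g hf hg => rw [map_add, MvPolynomial.coeff_add, hf, hg]; split_ifs <;> simp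
  | monomial n a =>
    rw [toFirst, Polynomial.aeval_monomial, MvPolynomial.algebraMap_eq,
      MvPolynomial.X_pow_eq_monomial, MvPolynomial.C_mul_monomial, MvPolynomial.coeff_monomial,
      Polynomial.coeff_monomial]
    have : single 0 n = d ↔ d 1 = 0 ∧ n = d 0 := by
      rw [DFunLike.ext_iff, Fin.forall_fin_two]
      simp; tauto
    by_cases h : d 1 = 0 <;> simp [this, h]

end PowerSeriesIrreducible

/-! ### Orders modulo `p`-th powers and irreducibility of `β(X₀) X₁ ^ p + φ(X₀)` -/

section Order

open Polynomial

variable {k : Type*} [Field k]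

/-- Modulo `p`-th powers a one-variable polynomial has order prime to `p`. -/
theorem exists_order_coprime [IsAlgClosed k] {p : ℕ} (hp : p.Prime) [CharP k p]
    {β : k[X]} (hβ : β.eval 0 ≠ 0) {φ : k[X]} (h0 : φ.eval 0 = 0)
    (hD : derivative φ * β - φ * derivative β ≠ 0) :
    ∃ (χ : k[X]) (m : ℕ) (η : k[X]), χ.eval 0 = 0 ∧ 0 < m ∧ p.Coprime m ∧ η.eval 0 ≠ 0 ∧
      φ + β * χ ^ p = X ^ m * η := by
  -- Terms `β χ ^ p` are added to `φ` to raise its order `m` as long as `p ∣ m`. The Wronskian with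
  -- `β` does not change, and its degree bounds `m`; `n` counts the steps left.
  suffices H : ∀ (n m : ℕ) (φ : k[X]), φ.eval 0 = 0 → X ^ m ∣ φ →
      derivative φ * β - φ * derivative β ≠ 0 →
      (derivative φ * β - φ * derivative β).natDegree + 1 < m + n →
      ∃ (χ : k[X]) (m : ℕ) (η : k[X]), χ.eval 0 = 0 ∧ 0 < m ∧ p.Coprime m ∧ η.eval 0 ≠ 0 ∧
        φ + β * χ ^ p = X ^ m * η from
    H _ 0 φ h0 (by simp) hD (by rw [zero_add]; exact Nat.lt_succ_self _)
  intro n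
  induction n with
  | zero =>
    intro m φ _ hm hD hlt
    exfalso
    -- If `X ^ m ∣ φ`, then `X ^ (m - 1)` divides the Wronskian, contradicting the degree bound.
    have hm' : X ^ (m - 1) ∣ φ := (pow_dvd_pow X (Nat.sub_le m 1)).trans hm
    obtain ⟨η, rfl⟩ := hm
    have hd : X ^ (m - 1) ∣ derivative (X ^ m * η) := by
      rw [derivative_mul, derivative_X_pow]
      refine dvd_add ⟨C (m : k) * η, by ring⟩ ⟨X ^ (m - (m - 1)) * derivative η, ?_⟩
      rw [← mul_assoc, ← pow_add, Nat.add_sub_cancel' (Nat.sub_le m 1)]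
    have := natDegree_le_of_dvd (dvd_sub (hd.mul_right β) (hm'.mul_right (derivative β))) hD
    rw [natDegree_X_pow] at this
    omega
  | succ n ih =>
    intro m φ h0 hm hD hlt
    have hm' := hm
    obtain ⟨η, hη⟩ := hm
    by_cases hη0 : η.eval 0 = 0
    · have : X ^ (m + 1) ∣ φ := by
        rw [hη, pow_succ]
        exact mul_dvd_mul_left _ (X_dvd_iff.2 (by rwa [coeff_zero_eq_eval_zero]))
      exact ih (m + 1) φ h0 this hD (by omega)
    · have hmpos : 0 < m := by
        rcases Nat.eq_zero_or_pos m with rfl | h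
        · simp [hη, hη0] at h0
        · exact h
      by_cases hpm : p ∣ m
      · obtain ⟨j, rfl⟩ := hpm
        have hj : 0 < j := Nat.pos_of_mul_pos_left hmpos
        -- Chosen so that `β (l X ^ j) ^ p` cancels the lowest term of `φ = X ^ (p j) η`.
        obtain ⟨l, hl⟩ := IsAlgClosed.exists_pow_nat_eq (-(η.eval 0) / β.eval 0) hp.pos
        have : Fact p.Prime := ⟨hp⟩
        set χ₁ : k[X] := C l * X ^ j with hχ₁
        have hpow : χ₁ ^ p = C (l ^ p) * X ^ (p * j) := by
          rw [hχ₁, mul_pow, ← C_pow, ← pow_mul, mul_comm j p]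
        have hder : derivative (χ₁ ^ p) = 0 := by
          rw [derivative_pow, CharP.cast_eq_zero, C_0]; ring
        have hDeq : derivative (φ + β * χ₁ ^ p) * β - (φ + β * χ₁ ^ p) * derivative β =
            derivative φ * β - φ * derivative β := by
          rw [derivative_add, derivative_mul, hder]; ring
        have hdvd : X ^ (p * j + 1) ∣ φ + β * χ₁ ^ p := by
          have : φ + β * χ₁ ^ p = X ^ (p * j) * (η + β * C (l ^ p)) := by
            rw [hη, hpow]; ring
          rw [this, pow_succ]
          refine mul_dvd_mul_left _ (X_dvd_iff.2 ?_)
          rw [coeff_zero_eq_eval_zero, eval_add, eval_mul, eval_C, hl]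
          field_simp
          ring
        obtain ⟨χ, m, η', hχ, hm0, hcop, hη', he⟩ := ih (p * j + 1) (φ + β * χ₁ ^ p)
          (by simp [h0, hχ₁, hj.ne', hp.ne_zero]) hdvd (by rwa [hDeq]) (by rw [hDeq]; omega)
        refine ⟨χ₁ + χ, m, η', by simp [hχ, hχ₁, hj.ne'], hm0, hcop, hη', ?_⟩
        rw [add_pow_char, ← he]; ring
      · exact ⟨0, m, η, by simp, hmpos, (Nat.Prime.coprime_iff_not_dvd hp).2 hpm, hη0,
          by rw [zero_pow hp.ne_zero, hη]; ring⟩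

/-- The local equation `β(X₀) X₁ ^ p + φ(X₀)` is irreducible as a power series unless `φ / β` has
zero derivative. -/
theorem irreducible_of_wronskian [IsAlgClosed k] {p : ℕ} (hp : p.Prime) [CharP k p]
    {β φ : k[X]} (hβ : β.eval 0 ≠ 0) (h0 : φ.eval 0 = 0)
    (hD : derivative φ * β - φ * derivative β ≠ 0) :
    Irreducible ((toFirst β * MvPolynomial.X 1 ^ p + toFirst φ : MvPolynomial (Fin 2) k) :
      MvPowerSeries (Fin 2) k) := by
  have : Fact p.Prime := ⟨hp⟩
  obtain ⟨χ, m, η, hχ, hm, hpm, hη, he⟩ := exists_order_coprime hp hβ h0 hD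
  -- Since `(X₁ + χ) ^ p = X₁ ^ p + χ ^ p`, this substitution replaces `φ` by `φ + β χ ^ p`. It is a
  -- local homomorphism, so irreducibility of the image suffices.
  set sub : Fin 2 → MvPolynomial (Fin 2) k :=
    ![MvPolynomial.X 0, MvPolynomial.X 1 + toFirst χ] with hsub
  have hc : ∀ f : k[X], MvPolynomial.constantCoeff (toFirst f) = f.eval 0 := fun f => by
    rw [MvPolynomial.constantCoeff_eq, coeff_toFirst]
    simp [coeff_zero_eq_eval_zero]
  have hsub0 : ∀ i, MvPowerSeries.constantCoeff (sub i : MvPowerSeries (Fin 2) k) = 0 := by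
    intro i
    rw [← MvPowerSeries.coeff_zero_eq_constantCoeff_apply, MvPolynomial.coeff_coe]
    fin_cases i
    · simp [hsub]
    · have := hc χ
      rw [MvPolynomial.constantCoeff_eq] at this
      simp [hsub, this, hχ]
  have hS : MvPowerSeries.HasSubst (fun i => (sub i : MvPowerSeries (Fin 2) k)) :=
    MvPowerSeries.hasSubst_of_constantCoeff_zero hsub0
  have hloc : IsLocalHom (MvPowerSeries.substAlgHom (R := k) hS) := by
    refine ⟨fun f hf => ?_⟩
    rw [MvPowerSeries.isUnit_iff_constantCoeff] at hf ⊢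
    rw [isUnit_iff_ne_zero] at hf ⊢
    intro h
    apply hf
    rw [MvPowerSeries.substAlgHom_apply]
    refine MvPowerSeries.constantCoeff_subst_eq_zero hS hsub0 h
  refine Irreducible.of_map (f := MvPowerSeries.substAlgHom (R := k) hS) ?_
  have himg : MvPowerSeries.substAlgHom (R := k) hS
      ((toFirst β * MvPolynomial.X 1 ^ p + toFirst φ : MvPolynomial (Fin 2) k) :
        MvPowerSeries (Fin 2) k) =
      ((toFirst β * MvPolynomial.X 1 ^ p + toFirst (X ^ m * η) : MvPolynomial (Fin 2) k) :
        MvPowerSeries (Fin 2) k) := by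
    rw [MvPowerSeries.substAlgHom_coe]
    have hcoe : ∀ q : MvPolynomial (Fin 2) k, MvPolynomial.aeval
        (fun i => (sub i : MvPowerSeries (Fin 2) k)) q =
        ((MvPolynomial.aeval sub q : MvPolynomial (Fin 2) k) : MvPowerSeries (Fin 2) k) := by
      intro q
      induction q using MvPolynomial.induction_on with
      | C a => simp [MvPowerSeries.algebraMap_apply]
      | add f g hf hg => rw [map_add, map_add, hf, hg, MvPolynomial.coe_add]
      | mul_X f i hf => simp [hf]
    rw [hcoe, ← he]
    congr 1
    have hfix : ∀ f : k[X], MvPolynomial.aeval sub (toFirst f) = toFirst f := fun f => by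
      rw [toFirst, ← Polynomial.aeval_algHom_apply, MvPolynomial.aeval_X, hsub]; rfl
    simp only [map_add, map_mul, map_pow, hfix, MvPolynomial.aeval_X]
    simp only [hsub, Matrix.cons_val_one, Matrix.cons_val_fin_one, add_pow_char]
    ring
  rw [himg]
  have hco : ∀ d : Fin 2 →₀ ℕ, MvPolynomial.coeff d
      (toFirst β * MvPolynomial.X 1 ^ p + toFirst (X ^ m * η)) =
      (if d 1 = p then β.coeff (d 0) else 0) +
        (if d 1 = 0 then (X ^ m * η).coeff (d 0) else 0) := by
    intro d
    rw [MvPolynomial.coeff_add, coeff_toFirst, MvPolynomial.X_pow_eq_monomial,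
      MvPolynomial.coeff_mul_monomial', coeff_toFirst]
    congr 1
    have hle : Finsupp.single 1 p ≤ d ↔ p ≤ d 1 := by
      simp
    by_cases h : p ≤ d 1
    · rw [if_pos (hle.2 h)]
      have : d 1 - p = 0 ↔ d 1 = p := by omega
      simp [this]
    · rw [if_neg (fun h' => h (hle.1 h')), if_neg (by omega)]
  refine irreducible_of_weight hp.pos hm hpm ?_ ?_ ?_
  · rw [MvPolynomial.coeff_coe, hco]
    simp [hp.ne_zero, coeff_zero_eq_eval_zero, hβ]
  · rw [MvPolynomial.coeff_coe, hco]
    simp [hp.ne_zero.symm, coeff_X_pow_mul', coeff_zero_eq_eval_zero, hη]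
  · intro d hd
    rw [MvPolynomial.coeff_coe, hco, coeff_X_pow_mul']
    have h1 : d 1 ≠ p := by rintro h; rw [h] at hd; nlinarith
    rw [if_neg h1]
    split_ifs with h2 h3
    · rw [h2] at hd; nlinarith
    · simp
    · simp

end Order

/-! ### Reducible power series -/

section PowerSeriesReducible

open MvPowerSeries

variable {k : Type*} [Field k] {σ : Type*}

/-- A contracting self-map of the maximal ideal of a power series ring has a fixed point. -/
theorem exists_fixedPoint (Φ : MvPowerSeries σ k → MvPowerSeries σ k)
    (h0 : ∀ x, constantCoeff x = 0 → constantCoeff (Φ x) = 0)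
    (h : ∀ x y, constantCoeff x = 0 → constantCoeff y = 0 →
      order (x - y) + 1 ≤ order (Φ x - Φ y)) :
    ∃ r, constantCoeff r = 0 ∧ Φ r = r := by
  set x : ℕ → MvPowerSeries σ k := fun n => Φ^[n] 0 with hx
  have hxs : ∀ n, x (n + 1) = Φ (x n) := fun n => Function.iterate_succ_apply' Φ n 0
  have hx0 : ∀ n, constantCoeff (x n) = 0 := fun n => by
    induction n with
    | zero => simp [hx]
    | succ n ih => rw [hxs]; exact h0 _ ih
  have hstep : ∀ n : ℕ, (n : ℕ∞) ≤ order (x (n + 1) - x n) := fun n => by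
    induction n with
    | zero => simp
    | succ n ih =>
      have := h _ _ (hx0 (n + 1)) (hx0 n)
      rw [← hxs (n + 1), ← hxs n] at this
      push_cast
      exact (add_le_add_left ih 1).trans this
  have hcoeff : ∀ (m j : ℕ) (d : σ →₀ ℕ), d.degree < m →
      coeff d (x (m + j)) = coeff d (x m) := fun m j d hd => by
    induction j with
    | zero => rfl
    | succ j ih =>
      rw [← ih, ← sub_eq_zero, ← map_sub]
      refine coeff_of_lt_order (lt_of_lt_of_le ?_ (hstep (m + j)))
      exact_mod_cast (by omega : d.degree < m + j)
  -- Coefficients of degree `n` are constant from the iterate `n + 1` on, so this is the limit of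
  -- the iteration.
  set r : MvPowerSeries σ k := fun d => coeff d (x (d.degree + 1)) with hr
  have hrc : ∀ d, coeff d r = coeff d (x (d.degree + 1)) := fun d => rfl
  have hr0 : constantCoeff r = 0 := by
    rw [← coeff_zero_eq_constantCoeff_apply, hrc, coeff_zero_eq_constantCoeff_apply, hx0]
  have happrox : ∀ n : ℕ, (n : ℕ∞) ≤ order (r - x n) := fun n => by
    refine nat_le_order fun d hd => ?_
    obtain ⟨j, rfl⟩ := Nat.exists_eq_add_of_lt hd
    rw [map_sub, hrc, add_right_comm, hcoeff _ j d (Nat.lt_succ_self _), sub_self]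
  refine ⟨r, hr0, ?_⟩
  rw [← sub_eq_zero, ← order_eq_top_iff, ENat.eq_top_iff_forall_ge]
  intro n
  have : Φ r - r = (Φ r - Φ (x n)) - (r - x (n + 1)) := by rw [hxs]; ring
  rw [this, sub_eq_add_neg]
  refine le_trans (le_min ?_ ?_) min_order_le_add
  · exact (happrox n).trans (le_self_add.trans (h _ _ hr0 (hx0 n)))
  · rw [order_neg]
    exact le_trans (by exact_mod_cast Nat.le_succ n) (happrox (n + 1))

/-- The inverse function theorem for power series, in the form of Hensel's lemma. -/
theorem exists_aeval_eq (q : Polynomial k) (h0 : q.coeff 0 = 0) (h1 : q.coeff 1 ≠ 0)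
    (ω : MvPowerSeries σ k) (hω : constantCoeff ω = 0) :
    ∃ r : MvPowerSeries σ k, constantCoeff r = 0 ∧ Polynomial.aeval r q = ω := by
  set h := q.divX.divX with hh
  have hq : ∀ r : MvPowerSeries σ k,
      Polynomial.aeval r q = r * (r * Polynomial.aeval r h + C (q.coeff 1)) := fun r => by
    have e1 := congrArg (Polynomial.aeval r) (Polynomial.divX_mul_X_add q)
    have e2 := congrArg (Polynomial.aeval r) (Polynomial.divX_mul_X_add q.divX)
    rw [map_add, map_mul, Polynomial.aeval_X, Polynomial.aeval_C] at e1 e2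
    rw [← e1, ← e2, h0, Polynomial.coeff_divX, map_zero, ← hh,
      MvPowerSeries.algebraMap_apply]
    simp only [zero_add, Algebra.algebraMap_self, RingHom.id_apply]
    ring
  -- With `q = q₁ X + X ^ 2 h`, the equation `q(r) = ω` reads `r = q₁⁻¹ (ω - r ^ 2 h(r))`. The
  -- quadratic factor makes the right side contracting on the maximal ideal.
  obtain ⟨r, hr0, hr⟩ := exists_fixedPoint
    (fun x => C (q.coeff 1)⁻¹ * (ω - x ^ 2 * Polynomial.aeval x h))
    (fun x hx => by simp [hω, hx]) (fun x y hx hy => by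
      obtain ⟨κ, hκ⟩ : x - y ∣ Polynomial.aeval x h - Polynomial.aeval y h :=
        by
        rw [← Polynomial.eval_map_algebraMap, ← Polynomial.eval_map_algebraMap]
        exact Polynomial.sub_dvd_eval_sub x y _
      have : C (q.coeff 1)⁻¹ * (ω - x ^ 2 * Polynomial.aeval x h) -
          C (q.coeff 1)⁻¹ * (ω - y ^ 2 * Polynomial.aeval y h) =
          (x - y) * (-C (q.coeff 1)⁻¹ * (x ^ 2 * κ + (x + y) * Polynomial.aeval y h)) := by
        linear_combination -C (q.coeff 1)⁻¹ * x ^ 2 * hκ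
      rw [this, order_mul]
      refine add_le_add_right ?_ _
      rw [one_le_order_iff_constCoeff_eq_zero]
      simp [hx, hy])
  refine ⟨r, hr0, ?_⟩
  have hc : (C (q.coeff 1) : MvPowerSeries σ k) * C (q.coeff 1)⁻¹ = 1 := by
    rw [← map_mul, mul_inv_cancel₀ h1, map_one]
  rw [hq]
  linear_combination (-C (q.coeff 1) : MvPowerSeries σ k) * hr +
    (ω - r ^ 2 * Polynomial.aeval r h) * hc

/-- A power series whose initial form is a product of at least two linear forms, one of which is
proportional to none of the others, is reducible. -/
theorem not_irreducible_of_tangents {p n : ℕ} (hp : 0 < p) (hn : 0 < n) (α : Fin n → k)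
    (hα : ∀ j, α j ≠ 0) {U V H : MvPowerSeries σ k} (hU : constantCoeff U = 0)
    (hV : constantCoeff V = 0) (hH : constantCoeff H ≠ 0) {d : σ →₀ ℕ} (hd : d.degree = 1)
    (hUd : coeff d U ≠ 0) :
    ¬ Irreducible (V ^ (n + 1) * V ^ p + H * (U * ∏ j, (U - C (α j) * V))) := by
  intro hirr
  obtain ⟨H', hH'⟩ : IsUnit H := by
    rw [MvPowerSeries.isUnit_iff_constantCoeff, isUnit_iff_ne_zero]; exact hH
  -- Zero is a simple root of `X ∏ (X - α j)` because all `α j` are nonzero. Hence some `r` in the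
  -- maximal ideal solves `r ∏ (r - α j) = -H⁻¹ V ^ p`, and `U = r V` will be a branch tangent to `U
  -- = 0`.
  obtain ⟨r, hr0, hr⟩ := exists_aeval_eq
    (Polynomial.X * ∏ j, (Polynomial.X - Polynomial.C (α j))) (by simp)
    (by
      rw [Polynomial.coeff_X_mul, Polynomial.coeff_zero_eq_eval_zero, Polynomial.eval_prod]
      simp [Finset.prod_ne_zero_iff, hα])
    (-((H'⁻¹ : (MvPowerSeries σ k)ˣ) * V ^ p : MvPowerSeries σ k)) (by simp [hV, hp.ne'])
  have hr' : V ^ p = -(H * (r * ∏ j, (r - C (α j)))) := by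
    have : r * ∏ j, (r - C (α j)) = -((H'⁻¹ : (MvPowerSeries σ k)ˣ) * V ^ p) := by
      rw [← hr]
      simp [MvPowerSeries.algebraMap_apply]
    rw [this, ← hH', mul_neg, neg_neg, Units.mul_inv_cancel_left]
  -- The series is `H (m(U) - m(r V))`, hence divisible by `U - r V`.
  set m : Polynomial (MvPowerSeries σ k) :=
    Polynomial.X * ∏ j, (Polynomial.X - Polynomial.C (C (α j) * V)) with hm
  have hmev : ∀ y, m.eval y = y * ∏ j, (y - C (α j) * V) := fun y => by
    simp [hm, Polynomial.eval_prod]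
  have hmr : m.eval (r * V) = V ^ (n + 1) * (r * ∏ j, (r - C (α j))) := by
    rw [hmev]
    have : ∀ j, r * V - C (α j) * V = V * (r - C (α j)) := fun j => by ring
    simp_rw [this]
    rw [Finset.prod_mul_distrib, Finset.prod_const, Finset.card_univ, Fintype.card_fin]
    ring
  obtain ⟨Q, hQ⟩ := Polynomial.sub_dvd_eval_sub U (r * V) m
  have hG : V ^ (n + 1) * V ^ p + H * (U * ∏ j, (U - C (α j) * V)) = (U - r * V) * (H * Q) := by
    rw [hr']
    rw [hmr, hmev] at hQ
    linear_combination H * hQ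
  have h2 : ∀ x y : MvPowerSeries σ k, constantCoeff x = 0 → constantCoeff y = 0 →
      2 ≤ order (x * y) := fun x y hx hy => by
    rw [← one_le_order_iff_constCoeff_eq_zero] at hx hy
    rw [order_mul]
    exact le_trans (by norm_num) (add_le_add hx hy)
  -- If the cofactor of `U - r V` were a unit, `U - r V` and hence `U` would have order at least
  -- two, although `U` has a linear term.
  have hord : 2 ≤ order (V ^ (n + 1) * V ^ p + H * (U * ∏ j, (U - C (α j) * V))) := by
    refine le_trans (le_min (h2 _ _ (by simp [hV]) (by simp [hV, hp.ne'])) ?_) min_order_le_add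
    rw [← mul_assoc]
    refine h2 _ _ (by simp [hU]) ?_
    rw [map_prod]
    exact Finset.prod_eq_zero (Finset.mem_univ ⟨0, hn⟩) (by simp [hU, hV])
  rw [hG] at hirr hord
  have hA : ¬ IsUnit (U - r * V) := by
    rw [MvPowerSeries.isUnit_iff_constantCoeff, isUnit_iff_ne_zero]; simp [hU, hV]
  rcases hirr.isUnit_or_isUnit rfl with h | h
  · exact hA h
  · rw [order_mul] at hord
    have hz : order (H * Q) = 0 := by
      rw [← not_ne_iff, ne_eq, ← ne_eq, order_ne_zero_iff_constCoeff_eq_zero]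
      rw [MvPowerSeries.isUnit_iff_constantCoeff, isUnit_iff_ne_zero] at h
      exact h
    rw [hz, add_zero] at hord
    have hU2 : 2 ≤ order U := by
      have : U = (U - r * V) + r * V := by ring
      rw [this]
      exact le_trans (le_min hord (h2 _ _ hr0 hV)) min_order_le_add
    have := hU2.trans (order_le hUd)
    rw [hd] at this
    exact absurd this (by norm_num)

end PowerSeriesReducible

/-! ### The equations over an arbitrary commutative ring -/

section Forms

variable {B : Type*} [CommRing B]

/-- The coefficients `σ 1, …, σ (p - 1)` over a ring. -/
def sigCoeff (p : ℕ) (s : Finset.Ioo 1 (p - 1) → B) (i : ℕ) : B :=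
  if h : i ∈ Finset.Ioo 1 (p - 1) then s ⟨i, h⟩ else 1

/-- The value of the form `σ`. -/
def sigmaForm (p : ℕ) (s : Finset.Ioo 1 (p - 1) → B) (x y : B) : B :=
  ∑ i ∈ Finset.Icc 1 (p - 1), sigCoeff p s i * x ^ i * y ^ (p - i)

/-- The form `g` of degree `p - 2` with `dσ = g (y dx - x dy)` in characteristic `p`. -/
def slopeForm (p : ℕ) (s : Finset.Ioo 1 (p - 1) → B) (x y : B) : B :=
  ∑ i ∈ Finset.Icc 1 (p - 1), (i : B) * sigCoeff p s i * x ^ (i - 1) * y ^ (p - 1 - i)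

/-- The binary form `u ∏ (u - α j v)` of degree `e`. -/
def tangentForm (e : ℕ) (α : Fin (e - 1) → B) (u v : B) : B :=
  if e = 0 then 1 else u * ∏ j, (u - α j * v)

/-- The derivative of the tangent form with respect to the first variable. -/
def tangentFormDu (e : ℕ) (α : Fin (e - 1) → B) (u v : B) : B :=
  if e = 0 then 0 else
    ∏ j, (u - α j * v) + u * ∑ j, ∏ i ∈ Finset.univ.erase j, (u - α i * v)

/-- The derivative of the tangent form with respect to the second variable. -/
def tangentFormDv (e : ℕ) (α : Fin (e - 1) → B) (u v : B) : B :=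
  if e = 0 then 0 else
    u * ∑ j, (∏ i ∈ Finset.univ.erase j, (u - α i * v)) * (-α j)

/-- The value of `L₀`. -/
def linU (w : Fin 4 → B) (x y : B) : B := w 2 * x - w 0 * y

/-- The value of `L₁`. -/
def linV (w : Fin 4 → B) (x y : B) : B := w 3 * x - w 1 * y

/-- The determinant `b₁ c₀ - b₀ c₁`. -/
def detW (w : Fin 4 → B) : B := w 1 * w 2 - w 0 * w 3

/-- The constant factor `(-1) ^ d π ^ p`. -/
def scaleC (p d : ℕ) (w : Fin 4 → B) : B := (-1) ^ d * detW w ^ p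

/-- The value of `∏ (L₀ - a_j ^ p L₁)`, including the factor `L₀`. -/
def lineVal (p d : ℕ) (a : Fin (d - p - 1) → B) (w : Fin 4 → B) (x y : B) : B :=
  tangentForm (d - p) (fun j => a j ^ p) (linU w x y) (linV w x y)

/-- The value of the derivative of `∏ (L₀ - a_j ^ p L₁)` with respect to `L₀`. -/
def lineValDu (p d : ℕ) (a : Fin (d - p - 1) → B) (w : Fin 4 → B) (x y : B) : B :=
  tangentFormDu (d - p) (fun j => a j ^ p) (linU w x y) (linV w x y)

/-- The value of the derivative of `∏ (L₀ - a_j ^ p L₁)` with respect to `L₁`. -/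
def lineValDv (p d : ℕ) (a : Fin (d - p - 1) → B) (w : Fin 4 → B) (x y : B) : B :=
  tangentFormDv (d - p) (fun j => a j ^ p) (linU w x y) (linV w x y)

/-- The value of the equation of the family. -/
def curveVal (p d : ℕ) (s : Finset.Ioo 1 (p - 1) → B) (a : Fin (d - p - 1) → B) (w : Fin 4 → B)
    (x y z : B) : B :=
  linV w x y ^ d - scaleC p d w * (sigmaForm p s x y - z ^ p) * lineVal p d a w x y

/-- The binary form whose zeros are the directions of the cusps, as seen from `[0 : 0 : 1]`. -/
def cuspForm (p d : ℕ) (s : Finset.Ioo 1 (p - 1) → B) (a : Fin (d - p - 1) → B) (w : Fin 4 → B)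
    (x y : B) : B :=
  detW w * linV w x y ^ (d - 1) * lineValDu p d a w x y -
    scaleC p d w * slopeForm p s x y * lineVal p d a w x y ^ 2

/-! ### Compatibility of the forms with ring homomorphisms -/

section Map

variable {B' : Type*} [CommRing B'] {F : Type*} [FunLike F B B'] [RingHomClass F B B'] (f : F)

theorem map_sigCoeff (p : ℕ) (s : Finset.Ioo 1 (p - 1) → B) (i : ℕ) :
    f (sigCoeff p s i) = sigCoeff p (fun i => f (s i)) i := by
  unfold sigCoeff; split_ifs <;> simp

theorem map_sigmaForm (p : ℕ) (s : Finset.Ioo 1 (p - 1) → B) (x y : B) :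
    f (sigmaForm p s x y) = sigmaForm p (fun i => f (s i)) (f x) (f y) := by
  simp [sigmaForm, map_sum, map_sigCoeff]

theorem map_slopeForm (p : ℕ) (s : Finset.Ioo 1 (p - 1) → B) (x y : B) :
    f (slopeForm p s x y) = slopeForm p (fun i => f (s i)) (f x) (f y) := by
  simp [slopeForm, map_sum, map_sigCoeff]

theorem map_linU (w : Fin 4 → B) (x y : B) :
    f (linU w x y) = linU (fun l => f (w l)) (f x) (f y) := by simp [linU]

theorem map_linV (w : Fin 4 → B) (x y : B) :
    f (linV w x y) = linV (fun l => f (w l)) (f x) (f y) := by simp [linV]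

theorem map_detW (w : Fin 4 → B) : f (detW w) = detW fun l => f (w l) := by simp [detW]

theorem map_scaleC (p d : ℕ) (w : Fin 4 → B) :
    f (scaleC p d w) = scaleC p d fun l => f (w l) := by simp [scaleC, map_detW]

theorem map_lineVal (p d : ℕ) (a : Fin (d - p - 1) → B) (w : Fin 4 → B) (x y : B) :
    f (lineVal p d a w x y) = lineVal p d (fun j => f (a j)) (fun l => f (w l)) (f x) (f y) := by
  unfold lineVal tangentForm; split_ifs <;> simp [map_linU, map_linV, map_prod]

theorem map_lineValDu (p d : ℕ) (a : Fin (d - p - 1) → B) (w : Fin 4 → B) (x y : B) :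
    f (lineValDu p d a w x y) =
      lineValDu p d (fun j => f (a j)) (fun l => f (w l)) (f x) (f y) := by
  unfold lineValDu tangentFormDu
  split_ifs <;> simp [map_linU, map_linV, map_prod, map_sum]

theorem map_lineValDv (p d : ℕ) (a : Fin (d - p - 1) → B) (w : Fin 4 → B) (x y : B) :
    f (lineValDv p d a w x y) =
      lineValDv p d (fun j => f (a j)) (fun l => f (w l)) (f x) (f y) := by
  unfold lineValDv tangentFormDv
  split_ifs <;> simp [map_linU, map_linV, map_prod, map_sum]

theorem map_curveVal (p d : ℕ) (s : Finset.Ioo 1 (p - 1) → B) (a : Fin (d - p - 1) → B)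
    (w : Fin 4 → B) (x y z : B) :
    f (curveVal p d s a w x y z) =
      curveVal p d (fun i => f (s i)) (fun j => f (a j)) (fun l => f (w l)) (f x) (f y) (f z) := by
  simp [curveVal, map_linV, map_scaleC, map_sigmaForm, map_lineVal]

theorem map_cuspForm (p d : ℕ) (s : Finset.Ioo 1 (p - 1) → B) (a : Fin (d - p - 1) → B)
    (w : Fin 4 → B) (x y : B) :
    f (cuspForm p d s a w x y) =
      cuspForm p d (fun i => f (s i)) (fun j => f (a j)) (fun l => f (w l)) (f x) (f y) := by
  simp [cuspForm, map_detW, map_linV, map_scaleC, map_slopeForm, map_lineVal, map_lineValDu]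

end Map

/-! ### Homogeneity -/

theorem linU_smul (w : Fin 4 → B) (t x y : B) : linU w (t * x) (t * y) = t * linU w x y := by
  unfold linU; ring

theorem linV_smul (w : Fin 4 → B) (t x y : B) : linV w (t * x) (t * y) = t * linV w x y := by
  unfold linV; ring

theorem sigmaForm_smul (p : ℕ) (s : Finset.Ioo 1 (p - 1) → B) (t x y : B) :
    sigmaForm p s (t * x) (t * y) = t ^ p * sigmaForm p s x y := by
  unfold sigmaForm
  rw [Finset.mul_sum]
  refine Finset.sum_congr rfl fun i hi => ?_
  rw [Finset.mem_Icc] at hi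
  have : t ^ p = t ^ i * t ^ (p - i) := by rw [← pow_add]; congr 1; omega
  rw [this, mul_pow, mul_pow]; ring

theorem slopeForm_smul (p : ℕ) (s : Finset.Ioo 1 (p - 1) → B) (t x y : B) :
    slopeForm p s (t * x) (t * y) = t ^ (p - 2) * slopeForm p s x y := by
  unfold slopeForm
  rw [Finset.mul_sum]
  refine Finset.sum_congr rfl fun i hi => ?_
  rw [Finset.mem_Icc] at hi
  have : t ^ (p - 2) = t ^ (i - 1) * t ^ (p - 1 - i) := by rw [← pow_add]; congr 1; omega
  rw [this, mul_pow, mul_pow]; ring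

theorem tangentForm_smul (e : ℕ) (α : Fin (e - 1) → B) (t u v : B) :
    tangentForm e α (t * u) (t * v) = t ^ e * tangentForm e α u v := by
  unfold tangentForm
  split_ifs with h
  · simp [h]
  · have : ∀ j, t * u - α j * (t * v) = t * (u - α j * v) := fun j => by ring
    simp_rw [this]
    rw [Finset.prod_mul_distrib, Finset.prod_const, Finset.card_univ, Fintype.card_fin]
    obtain ⟨n, rfl⟩ := Nat.exists_eq_succ_of_ne_zero h
    simp only [Nat.succ_eq_add_one, Nat.add_sub_cancel]
    ring

theorem tangentFormDu_smul (e : ℕ) (α : Fin (e - 1) → B) (t u v : B) :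
    tangentFormDu e α (t * u) (t * v) = t ^ (e - 1) * tangentFormDu e α u v := by
  unfold tangentFormDu
  split_ifs with h
  · simp
  · have : ∀ j, t * u - α j * (t * v) = t * (u - α j * v) := fun j => by ring
    simp_rw [this, Finset.prod_mul_distrib, Finset.prod_const]
    have h2 : ∀ j : Fin (e - 1), (Finset.univ.erase j).card = e - 1 - 1 := fun j => by
      rw [Finset.card_erase_of_mem (Finset.mem_univ j), Finset.card_univ, Fintype.card_fin]
    simp_rw [h2, ← Finset.mul_sum]
    rw [Finset.card_univ, Fintype.card_fin]
    rcases Nat.eq_zero_or_pos (e - 1) with h0 | h0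
    · have : IsEmpty (Fin (e - 1)) := by rw [h0]; infer_instance
      simp [h0]
    · have : t ^ (e - 1) = t * t ^ (e - 1 - 1) := by rw [← pow_succ']; congr 1; omega
      rw [this]; ring

theorem lineVal_smul (p d : ℕ) (a : Fin (d - p - 1) → B) (w : Fin 4 → B) (t x y : B) :
    lineVal p d a w (t * x) (t * y) = t ^ (d - p) * lineVal p d a w x y := by
  rw [lineVal, linU_smul, linV_smul, tangentForm_smul]; rfl

theorem lineValDu_smul (p d : ℕ) (a : Fin (d - p - 1) → B) (w : Fin 4 → B) (t x y : B) :
    lineValDu p d a w (t * x) (t * y) = t ^ (d - p - 1) * lineValDu p d a w x y := by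
  rw [lineValDu, linU_smul, linV_smul, tangentFormDu_smul]; rfl

theorem lineValDu_of_eq (p d : ℕ) (hde : d - p = 0) (a : Fin (d - p - 1) → B) (w : Fin 4 → B)
    (x y : B) : lineValDu p d a w x y = 0 := by
  simp [lineValDu, tangentFormDu, hde]

theorem lineValDv_of_eq (p d : ℕ) (hde : d - p = 0) (a : Fin (d - p - 1) → B) (w : Fin 4 → B)
    (x y : B) : lineValDv p d a w x y = 0 := by
  simp [lineValDv, tangentFormDv, hde]

theorem lineVal_of_eq (p d : ℕ) (hde : d - p = 0) (a : Fin (d - p - 1) → B) (w : Fin 4 → B)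
    (x y : B) : lineVal p d a w x y = 1 := by
  simp [lineVal, tangentForm, hde]

theorem curveVal_smul {p d : ℕ} (hd : p ≤ d) (s : Finset.Ioo 1 (p - 1) → B)
    (a : Fin (d - p - 1) → B) (w : Fin 4 → B) (t x y z : B) :
    curveVal p d s a w (t * x) (t * y) (t * z) = t ^ d * curveVal p d s a w x y z := by
  have h : t ^ d = t ^ p * t ^ (d - p) := by rw [← pow_add, Nat.add_sub_cancel' hd]
  rw [curveVal, curveVal, linV_smul, sigmaForm_smul, lineVal_smul, mul_pow, mul_pow, h]
  ring

theorem cuspForm_smul {p d : ℕ} (hp : 2 ≤ p) (hd : p ≤ d) (s : Finset.Ioo 1 (p - 1) → B)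
    (a : Fin (d - p - 1) → B) (w : Fin 4 → B) (t x y : B) :
    cuspForm p d s a w (t * x) (t * y) = t ^ (2 * d - p - 2) * cuspForm p d s a w x y := by
  have h2 : t ^ (2 * d - p - 2) = t ^ (p - 2) * (t ^ (d - p)) ^ 2 := by
    rw [← pow_mul, ← pow_add]; congr 1; omega
  have h1 : t ^ (d - 1) * (t ^ (d - p - 1) * lineValDu p d a w x y) =
      t ^ (2 * d - p - 2) * lineValDu p d a w x y := by
    by_cases hde : d - p = 0
    · simp [lineValDu_of_eq p d hde]
    · rw [← mul_assoc, ← pow_add]; congr 2; omega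
  rw [cuspForm, cuspForm, linV_smul, slopeForm_smul, lineVal_smul, lineValDu_smul, mul_pow,
    mul_pow]
  linear_combination (detW w * linV w x y ^ (d - 1)) * h1 +
    scaleC p d w * slopeForm p s x y * lineVal p d a w x y ^ 2 * h2

/-! ### Derivations -/

section Derivation

variable {A : Type*} [CommRing A] [Algebra A B] (D : Derivation A B B)

theorem derivation_prod {ι : Type*} [DecidableEq ι] (S : Finset ι) (f : ι → B) :
    D (∏ i ∈ S, f i) = ∑ i ∈ S, (∏ j ∈ S.erase i, f j) * D (f i) := by
  induction S using Finset.induction_on with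
  | empty => simp
  | insert i S hi ih =>
    rw [Finset.prod_insert hi, Derivation.leibniz, ih, Finset.sum_insert hi,
      Finset.erase_insert hi, smul_eq_mul, smul_eq_mul, Finset.mul_sum, add_comm]
    refine congrArg₂ _ rfl (Finset.sum_congr rfl fun j hj => ?_)
    rw [Finset.erase_insert_of_ne (by rintro rfl; exact hi hj),
      Finset.prod_insert (fun h => hi (Finset.mem_of_mem_erase h)), mul_assoc]

theorem derivation_tangentForm (e : ℕ) (α : Fin (e - 1) → B) (hα : ∀ j, D (α j) = 0) (u v : B) :
    D (tangentForm e α u v) = tangentFormDu e α u v * D u + tangentFormDv e α u v * D v := by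
  unfold tangentForm tangentFormDu tangentFormDv
  split_ifs with h
  · simp
  · rw [Derivation.leibniz, derivation_prod]
    have : ∀ j, D (u - α j * v) = D u + (-α j) * D v := fun j => by
      rw [map_sub, Derivation.leibniz, hα]; simp; ring
    simp_rw [this, mul_add, Finset.sum_add_distrib, ← mul_assoc, ← Finset.sum_mul]
    simp only [smul_eq_mul]
    ring

/-- Euler's identity for a form of degree `e`. It is applied with `e = d - p`, which equals `d` in
characteristic `p`. -/
theorem tangentForm_euler (e : ℕ) (α : Fin (e - 1) → B) (u v : B) :
    u * tangentFormDu e α u v + v * tangentFormDv e α u v = e * tangentForm e α u v := by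
  unfold tangentForm tangentFormDu tangentFormDv
  split_ifs with h
  · simp [h]
  · have h1 : u * ∑ j, ∏ i ∈ Finset.univ.erase j, (u - α i * v) +
        v * ∑ j, (∏ i ∈ Finset.univ.erase j, (u - α i * v)) * (-α j) =
        ((e - 1 : ℕ) : B) * ∏ j, (u - α j * v) := by
      rw [Finset.mul_sum, Finset.mul_sum, ← Finset.sum_add_distrib]
      have : ∀ j : Fin (e - 1), u * ∏ i ∈ Finset.univ.erase j, (u - α i * v) +
          v * ((∏ i ∈ Finset.univ.erase j, (u - α i * v)) * (-α j)) = ∏ i, (u - α i * v) := by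
        intro j
        rw [← Finset.mul_prod_erase _ _ (Finset.mem_univ j)]
        ring
      simp_rw [this]
      simp
    have h2 : ((e - 1 : ℕ) : B) = e - 1 := by
      rw [Nat.cast_sub (Nat.one_le_iff_ne_zero.2 h), Nat.cast_one]
    rw [h2] at h1
    linear_combination u * h1

theorem derivation_pow_char {p : ℕ} [CharP B p] (x : B) : D (x ^ p) = 0 := by
  rw [Derivation.leibniz_pow, nsmul_eq_mul, CharP.cast_eq_zero, zero_mul]

/-- In the differential of `x ^ i y ^ (p - i)` the two exponents are opposite modulo `p`, so `y dx -
x dy` factors out of each monomial. -/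
theorem derivation_sigmaForm {p : ℕ} [CharP B p] (s : Finset.Ioo 1 (p - 1) → B)
    (hs : ∀ i, D (s i) = 0) (x y : B) :
    D (sigmaForm p s x y) = slopeForm p s x y * (y * D x - x * D y) := by
  unfold sigmaForm slopeForm
  rw [map_sum, Finset.sum_mul]
  refine Finset.sum_congr rfl fun i hi => ?_
  rw [Finset.mem_Icc] at hi
  have h0 : D (sigCoeff p s i) = 0 := by
    unfold sigCoeff; split_ifs
    · exact hs _
    · simp
  have hc : ((p - i : ℕ) : B) = -i := by
    rw [Nat.cast_sub (by omega), CharP.cast_eq_zero, zero_sub]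
  have hy : y ^ (p - i) = y ^ (p - 1 - i) * y := by rw [← pow_succ]; congr 1; omega
  have hx : x ^ i = x ^ (i - 1) * x := by rw [← pow_succ]; congr 1; omega
  have hi' : p - i - 1 = p - 1 - i := by omega
  rw [Derivation.leibniz, Derivation.leibniz, Derivation.leibniz_pow, Derivation.leibniz_pow, h0]
  simp only [nsmul_eq_mul, smul_eq_mul, hc, hi']
  rw [hy, hx]
  ring

theorem derivation_curveVal {p d : ℕ} [CharP B p] (s : Finset.Ioo 1 (p - 1) → B)
    (hs : ∀ i, D (s i) = 0) (a : Fin (d - p - 1) → B) (w : Fin 4 → B) (x y z : B) :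
    D (curveVal p d s a w x y z) =
      d * linV w x y ^ (d - 1) * D (linV w x y) -
      scaleC p d w * (slopeForm p s x y * (y * D x - x * D y) * lineVal p d a w x y +
        (sigmaForm p s x y - z ^ p) * (lineValDu p d a w x y * D (linU w x y) +
          lineValDv p d a w x y * D (linV w x y))) := by
  have hc : D (scaleC p d w) = 0 := by
    rw [scaleC, Derivation.leibniz, derivation_pow_char, Derivation.leibniz_pow]; simp
  have hM := derivation_tangentForm D (d - p) (fun j => a j ^ p)
    (fun j => derivation_pow_char D (a j)) (linU w x y) (linV w x y)
  rw [curveVal, map_sub, Derivation.leibniz_pow, Derivation.leibniz, Derivation.leibniz, hc,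
    map_sub, derivation_sigmaForm D s hs, derivation_pow_char, lineVal, hM]
  simp only [nsmul_eq_mul, smul_eq_mul, lineValDu, lineValDv]
  ring

/-- The fundamental identity between the equation of the curve and the cusp form. -/
theorem lineVal_mul_derivation {p d : ℕ} [CharP B p] (hp : 0 < p) (hd : p ≤ d)
    (s : Finset.Ioo 1 (p - 1) → B) (hs : ∀ i, D (s i) = 0) (a : Fin (d - p - 1) → B)
    (w : Fin 4 → B) (hw : ∀ l, D (w l) = 0) (x y z : B) :
    lineVal p d a w x y * D (curveVal p d s a w x y z) =
      cuspForm p d s a w x y * (y * D x - x * D y) +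
        curveVal p d s a w x y z * D (lineVal p d a w x y) := by
  have hM : D (lineVal p d a w x y) = lineValDu p d a w x y * D (linU w x y) +
      lineValDv p d a w x y * D (linV w x y) := derivation_tangentForm D (d - p) _
    (fun j => derivation_pow_char D (a j)) (linU w x y) (linV w x y)
  have hE : linU w x y * lineValDu p d a w x y + linV w x y * lineValDv p d a w x y =
      d * lineVal p d a w x y := by
    have := tangentForm_euler (d - p) (fun j => a j ^ p) (linU w x y) (linV w x y)
    rwa [Nat.cast_sub hd, CharP.cast_eq_zero B p, sub_zero] at this
  have hU : D (linU w x y) = w 2 * D x - w 0 * D y := by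
    rw [linU, map_sub, Derivation.leibniz, Derivation.leibniz, hw, hw]; simp
  have hV : D (linV w x y) = w 3 * D x - w 1 * D y := by
    rw [linV, map_sub, Derivation.leibniz, Derivation.leibniz, hw, hw]; simp
  have hW : linU w x y * (w 3 * D x - w 1 * D y) - linV w x y * (w 2 * D x - w 0 * D y) =
      detW w * (y * D x - x * D y) := by
    unfold linU linV detW; ring
  have hpow : linV w x y ^ d = linV w x y ^ (d - 1) * linV w x y := by
    rw [← pow_succ]; congr 1; omega
  rw [derivation_curveVal D s hs, hM, hU, hV, curveVal, cuspForm, hpow]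
  -- The terms with `S DM` cancel in `M DF - F DM`, leaving `V ^ (d - 1) (d M DV - V DM) - c g M ^ 2
  -- (y Dx - x Dy)`. Euler's identity turns the bracket into `M_U (U DV - V DU)`, and `hW` evaluates
  -- that.
  linear_combination (-linV w x y ^ (d - 1) * (w 3 * D x - w 1 * D y)) * hE +
    linV w x y ^ (d - 1) * lineValDu p d a w x y * hW

end Derivation

end Forms

/-! ### Geometry of the fibers away from `[0 : 0 : 1]` -/

section Fiber

open MvPolynomial

variable {k : Type*} [Field k]

theorem fiberEq_eq (p d : ℕ) (s : Finset.Ioo 1 (p - 1) → k) (a : Fin (d - p - 1) → k)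
    (w : Fin 4 → k) :
    fiberEq p d s a w = curveVal p d (fun i => C (s i)) (fun j => C (a j)) (fun l => C (w l))
      (X 0) (X 1) (X 2) := by
  have hs : ∀ i, C (sigmaCoeff p s i) = sigCoeff p (fun i => (C (s i) : MvPolynomial (Fin 3) k)) i
      := fun i => by unfold sigmaCoeff sigCoeff; split_ifs <;> simp
  have hb : aeval (Sum.elim X fun l => C (w l)) (rename Sum.inl (boundary p s)) =
      sigmaForm p (fun i => (C (s i) : MvPolynomial (Fin 3) k)) (X 0) (X 1) - X 2 ^ p := by
    rw [aeval_rename]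
    simp [boundary, sigmaForm, ← hs]
  have hl : aeval (Sum.elim X fun l => C (w l)) (linePart p d a) =
      lineVal p d (fun j => (C (a j) : MvPolynomial (Fin 3) k)) (fun l => C (w l)) (X 0) (X 1) := by
    unfold linePart lineVal tangentForm
    split_ifs
    · simp
    · simp [L₀, L₁, linU, linV, map_prod, algebraMap_eq]
  rw [fiberEq, totalEq, map_sub, map_mul, map_mul, hb, hl]
  simp [L₁, disc, curveVal, linV, scaleC, detW]

theorem totalEq_eq (p d : ℕ) (s : Finset.Ioo 1 (p - 1) → k) (a : Fin (d - p - 1) → k) :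
    totalEq p d s a = curveVal p d (fun i => C (s i)) (fun j => C (a j)) (fun l => X (.inr l))
      (X (.inl 0)) (X (.inl 1)) (X (.inl 2)) := by
  have hs : ∀ i, C (sigmaCoeff p s i) = sigCoeff p (fun i => (C (s i) : FamilyRing k)) i
      := fun i => by unfold sigmaCoeff sigCoeff; split_ifs <;> simp
  have hb : rename Sum.inl (boundary p s) =
      sigmaForm p (fun i => (C (s i) : FamilyRing k)) (X (.inl 0)) (X (.inl 1)) -
        X (.inl 2) ^ p := by
    simp [boundary, sigmaForm, ← hs]
  have hl : linePart p d a =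
      lineVal p d (fun j => (C (a j) : FamilyRing k)) (fun l => X (.inr l)) (X (.inl 0))
        (X (.inl 1)) := by
    unfold linePart lineVal tangentForm
    split_ifs
    · simp
    · simp [L₀, L₁, linU, linV]
  rw [totalEq, hb, hl]
  simp [L₁, disc, curveVal, linV, scaleC, detW]

theorem eval_fiberEq (p d : ℕ) (s : Finset.Ioo 1 (p - 1) → k) (a : Fin (d - p - 1) → k)
    (w : Fin 4 → k) (x : Fin 3 → k) :
    eval x (fiberEq p d s a w) = curveVal p d s a w (x 0) (x 1) (x 2) := by
  rw [fiberEq_eq, map_curveVal]; simp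

theorem eval_totalEq (p d : ℕ) (s : Finset.Ioo 1 (p - 1) → k) (a : Fin (d - p - 1) → k)
    (w : Fin 4 → k) (x : Fin 3 → k) :
    eval (Sum.elim x w) (totalEq p d s a) = curveVal p d s a w (x 0) (x 1) (x 2) := by
  rw [totalEq_eq, map_curveVal]; simp

theorem linUV_ne_zero {w : Fin 4 → k} (hw : detW w ≠ 0) {x y : k} (h : x ≠ 0 ∨ y ≠ 0)
    (hV : linV w x y = 0) : linU w x y ≠ 0 := by
  intro hU
  have hx : detW w * x = 0 := by
    unfold linU linV detW at *; linear_combination w 1 * hU - w 0 * hV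
  have hy : detW w * y = 0 := by
    unfold linU linV detW at *; linear_combination w 3 * hU - w 2 * hV
  rcases h with h | h
  · exact h ((mul_eq_zero.1 hx).resolve_left hw)
  · exact h ((mul_eq_zero.1 hy).resolve_left hw)

theorem tangentForm_zero_right (e : ℕ) (α : Fin (e - 1) → k) (u : k) :
    tangentForm e α u 0 = u ^ e := by
  unfold tangentForm
  split_ifs with h
  · simp [h]
  · obtain ⟨n, rfl⟩ := Nat.exists_eq_succ_of_ne_zero h
    simp [pow_succ']

theorem lineVal_ne_zero_of_linV {p d : ℕ} (a : Fin (d - p - 1) → k) {w : Fin 4 → k}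
    (hw : detW w ≠ 0) {x y : k} (h : x ≠ 0 ∨ y ≠ 0) (hV : linV w x y = 0) :
    lineVal p d a w x y ≠ 0 := by
  rw [lineVal, hV, tangentForm_zero_right]
  exact pow_ne_zero _ (linUV_ne_zero hw h hV)

/-- On the curve `M = 0` forces `V = 0`, where `M` is a power of `U`. But `U` and `V` are
independent linear forms in `x`, `y`. -/
theorem lineVal_ne_zero {p d : ℕ} (hd : d ≠ 0) (s : Finset.Ioo 1 (p - 1) → k)
    (a : Fin (d - p - 1) → k) {w : Fin 4 → k} (hw : detW w ≠ 0) {x y z : k} (h : x ≠ 0 ∨ y ≠ 0)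
    (hF : curveVal p d s a w x y z = 0) : lineVal p d a w x y ≠ 0 := by
  intro hM
  rw [curveVal, hM, mul_zero, sub_zero] at hF
  exact lineVal_ne_zero_of_linV a hw h (pow_eq_zero_iff hd |>.1 hF) hM

theorem scaleC_ne_zero (p d : ℕ) {w : Fin 4 → k} (hw : detW w ≠ 0) : scaleC p d w ≠ 0 :=
  mul_ne_zero (pow_ne_zero _ (by simp)) (pow_ne_zero _ hw)

/-- On the curve the fundamental identity becomes `M ∂F = R (y ∂x - x ∂y)` with `M ≠ 0`, and one of
the factors `y`, `x` is nonzero. -/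
theorem isSingularAt_fiberEq_iff {p d : ℕ} (hp : 0 < p) [CharP k p] (hd : p ≤ d)
    (s : Finset.Ioo 1 (p - 1) → k) (a : Fin (d - p - 1) → k) {w : Fin 4 → k} (hw : detW w ≠ 0)
    {x : Fin 3 → k} (h : x 0 ≠ 0 ∨ x 1 ≠ 0) :
    IsSingularAt (fiberEq p d s a w) x ↔
      curveVal p d s a w (x 0) (x 1) (x 2) = 0 ∧ cuspForm p d s a w (x 0) (x 1) = 0 := by
  rw [IsSingularAt, eval_fiberEq]
  refine and_congr_right fun hF => ?_
  have hM := lineVal_ne_zero (by omega) s a hw h hF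
  have key : ∀ i, lineVal p d a w (x 0) (x 1) * eval x (pderiv i (fiberEq p d s a w)) =
      cuspForm p d s a w (x 0) (x 1) *
        (x 1 * eval x (pderiv i (X 0)) - x 0 * eval x (pderiv i (X 1))) := fun i => by
    have := congrArg (eval x) (lineVal_mul_derivation (pderiv i) hp hd
      (fun i => (C (s i) : MvPolynomial (Fin 3) k)) (fun i => by simp) (fun j => C (a j))
      (fun l => C (w l)) (fun l => by simp) (X 0) (X 1) (X 2))
    rw [← fiberEq_eq] at this
    simpa [map_lineVal, map_cuspForm, eval_fiberEq, hF] using this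
  constructor
  · intro hall
    rcases h with h | h
    · have := key 1
      rw [hall 1] at this
      simpa [h, pderiv_X] using this
    · have := key 0
      rw [hall 0] at this
      simpa [h, pderiv_X] using this
  · intro hc i
    have := key i
    rw [hc, zero_mul] at this
    exact (mul_eq_zero.1 this).resolve_left hM

/-- As `π ^ p` is killed by derivations, `b₀`, `c₀` act only through `U` and `b₁`, `c₁` only through
`V`. Their partial derivatives isolate the coefficients of `dU` and `dV`, and what remains in the
plane directions is a multiple of `g`. -/
theorem isSingularAt_totalEq_iff {p d : ℕ} (hp : 0 < p) [CharP k p] (hd : p ≤ d)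
    (s : Finset.Ioo 1 (p - 1) → k) (a : Fin (d - p - 1) → k) {w : Fin 4 → k} (hw : detW w ≠ 0)
    {x : Fin 3 → k} (h : x 0 ≠ 0 ∨ x 1 ≠ 0)
    (hF : curveVal p d s a w (x 0) (x 1) (x 2) = 0) :
    IsSingularAt (totalEq p d s a) (Sum.elim x w) ↔
      slopeForm p s (x 0) (x 1) = 0 ∧
      (sigmaForm p s (x 0) (x 1) - x 2 ^ p) * lineValDu p d a w (x 0) (x 1) = 0 ∧
      d * linV w (x 0) (x 1) ^ (d - 1) = scaleC p d w *
        ((sigmaForm p s (x 0) (x 1) - x 2 ^ p) * lineValDv p d a w (x 0) (x 1)) := by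
  have hM := lineVal_ne_zero (by omega) s a hw h hF
  have hc := scaleC_ne_zero p d hw
  rw [IsSingularAt, eval_totalEq, Sum.forall]
  set S := sigmaForm p s (x 0) (x 1) - x 2 ^ p
  set ev := eval (Sum.elim x w)
  have key : ∀ i, ev (pderiv i (totalEq p d s a)) =
      d * linV w (x 0) (x 1) ^ (d - 1) *
        ev (pderiv i (linV (fun l => X (.inr l)) (X (.inl 0)) (X (.inl 1)))) -
      scaleC p d w * (slopeForm p s (x 0) (x 1) * (x 1 * ev (pderiv i (X (.inl 0))) -
        x 0 * ev (pderiv i (X (.inl 1)))) * lineVal p d a w (x 0) (x 1) +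
        S * (lineValDu p d a w (x 0) (x 1) *
            ev (pderiv i (linU (fun l => X (.inr l)) (X (.inl 0)) (X (.inl 1)))) +
          lineValDv p d a w (x 0) (x 1) *
            ev (pderiv i (linV (fun l => X (.inr l)) (X (.inl 0)) (X (.inl 1)))))) := fun i => by
    have := congrArg ev (derivation_curveVal (pderiv i)
      (fun i => (C (s i) : FamilyRing k)) (fun i => by simp) (fun j => (C (a j) : FamilyRing k))
      (fun l => X (.inr l)) (X (.inl 0)) (X (.inl 1)) (X (.inl 2)))
    rw [← totalEq_eq] at this
    rw [this]
    simp only [map_sub, map_mul, map_add, map_pow, map_natCast, map_linV, map_scaleC,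
      map_slopeForm, map_sigmaForm, map_lineVal, map_lineValDu, map_lineValDv, ev, eval_C, eval_X,
      Sum.elim_inl, Sum.elim_inr, S]
  have hV : ∀ i, ev (pderiv i (linV (fun l => X (.inr l)) (X (.inl 0)) (X (.inl 1)))) =
      w 3 * ev (pderiv i (X (.inl 0))) + x 0 * ev (pderiv i (X (.inr 3))) -
      (w 1 * ev (pderiv i (X (.inl 1))) + x 1 * ev (pderiv i (X (.inr 1)))) := fun i => by
    rw [linV, map_sub, Derivation.leibniz, Derivation.leibniz]; simp [ev]
  have hU : ∀ i, ev (pderiv i (linU (fun l => X (.inr l)) (X (.inl 0)) (X (.inl 1)))) =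
      w 2 * ev (pderiv i (X (.inl 0))) + x 0 * ev (pderiv i (X (.inr 2))) -
      (w 0 * ev (pderiv i (X (.inl 1))) + x 1 * ev (pderiv i (X (.inr 0)))) := fun i => by
    rw [linU, map_sub, Derivation.leibniz, Derivation.leibniz]; simp [ev]
  have hX : ∀ i j, ev (pderiv i (X j)) = if j = i then 1 else 0 := fun i j => by
    rw [pderiv_X, Pi.single_apply]; split_ifs <;> simp
  simp only [key, hU, hV, hX]
  clear_value ev S
  set v := linV w (x 0) (x 1)
  set M := lineVal p d a w (x 0) (x 1)
  set Mu := lineValDu p d a w (x 0) (x 1)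
  set Mv := lineValDv p d a w (x 0) (x 1)
  set g := slopeForm p s (x 0) (x 1)
  set c := scaleC p d w
  constructor
  · rintro ⟨-, h1, h2⟩
    have h1x := h1 0
    have h1y := h1 1
    have f0 := h2 0
    have f1 := h2 1
    have f2 := h2 2
    have f3 := h2 3
    simp only [Sum.inl.injEq, Sum.inr.injEq, reduceCtorEq, if_true, if_false, Fin.reduceEq]
      at h1x h1y f0 f1 f2 f3
    have hu : S * Mu = 0 := by
      rcases h with h | h
      · refine (mul_eq_zero.1 (?_ : (c * x 0) * (S * Mu) = 0)).resolve_left (mul_ne_zero hc h)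
        linear_combination -f2
      · refine (mul_eq_zero.1 (?_ : (c * x 1) * (S * Mu) = 0)).resolve_left (mul_ne_zero hc h)
        linear_combination f0
    have hv : d * v ^ (d - 1) = c * (S * Mv) := by
      rw [← sub_eq_zero]
      rcases h with h | h
      · refine (mul_eq_zero.1 (?_ : x 0 * _ = 0)).resolve_left h
        linear_combination f3
      · refine (mul_eq_zero.1 (?_ : x 1 * _ = 0)).resolve_left h
        linear_combination -f1
    refine ⟨?_, hu, hv⟩
    rcases h with h | h
    · refine (mul_eq_zero.1 (?_ : (c * M * x 0) * g = 0)).resolve_left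
        (mul_ne_zero (mul_ne_zero hc hM) h)
      linear_combination h1y - c * w 0 * hu + w 1 * hv
    · refine (mul_eq_zero.1 (?_ : (c * M * x 1) * g = 0)).resolve_left
        (mul_ne_zero (mul_ne_zero hc hM) h)
      linear_combination -h1x - c * w 2 * hu + w 3 * hv
  · rintro ⟨hg, hu, hv⟩
    rw [hg]
    have hlin : ∀ Z A A' : k, d * v ^ (d - 1) * A -
        c * (0 * Z * M + S * (Mu * A' + Mv * A)) = 0 := fun Z A A' => by
      linear_combination A * hv - c * A' * hu
    exact ⟨hF, fun i => hlin _ _ _, fun i => hlin _ _ _⟩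

/-! ### Local equations -/

open Polynomial in
/-- The curve is unibranch where the cusp form does not vanish identically. -/
theorem irreducible_curveVal [IsAlgClosed k] {p d : ℕ} (hp : p.Prime) [CharP k p] (hd : p ≤ d)
    (s : Finset.Ioo 1 (p - 1) → k) (a : Fin (d - p - 1) → k) {w : Fin 4 → k} (hw : detW w ≠ 0)
    (ξ η : k[X]) (z : k) (h : ξ.eval 0 ≠ 0 ∨ η.eval 0 ≠ 0)
    (hF : curveVal p d s a w (ξ.eval 0) (η.eval 0) z = 0)
    (hc : cuspForm p d (fun i => Polynomial.C (s i)) (fun j => Polynomial.C (a j))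
      (fun l => Polynomial.C (w l)) ξ η * (η * derivative ξ - ξ * derivative η) ≠ 0) :
    Irreducible ((curveVal p d (fun i => MvPolynomial.C (s i)) (fun j => MvPolynomial.C (a j))
      (fun l => MvPolynomial.C (w l)) (toFirst ξ) (toFirst η)
      (MvPolynomial.X 1 + MvPolynomial.C z) : MvPolynomial (Fin 2) k) :
        MvPowerSeries (Fin 2) k) := by
  have : Fact p.Prime := ⟨hp⟩
  have hd0 : d ≠ 0 := by have := hp.pos; omega
  set s' : Finset.Ioo 1 (p - 1) → k[X] := fun i => Polynomial.C (s i)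
  set a' : Fin (d - p - 1) → k[X] := fun j => Polynomial.C (a j)
  set w' : Fin 4 → k[X] := fun l => Polynomial.C (w l)
  have hf : ∀ t : k, toFirst (Polynomial.C t) = MvPolynomial.C t := fun t => by
    simp [toFirst, MvPolynomial.algebraMap_eq]
  have hsplit : curveVal p d (fun i => MvPolynomial.C (s i)) (fun j => MvPolynomial.C (a j))
      (fun l => MvPolynomial.C (w l)) (toFirst ξ) (toFirst η)
      (MvPolynomial.X 1 + MvPolynomial.C z) =
      -- The shape `β X₁ ^ p + φ`: `β = c M`, and `φ` is the equation restricted to constant third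
      -- coordinate `z`.
      toFirst (scaleC p d w' * lineVal p d a' w' ξ η) * MvPolynomial.X 1 ^ p +
        toFirst (curveVal p d s' a' w' ξ η (Polynomial.C z)) := by
    rw [map_mul, map_scaleC, map_lineVal, map_curveVal]
    simp only [hf, s', a', w', curveVal, add_pow_char]
    ring
  have hev : ∀ t : k, (Polynomial.evalRingHom 0) (Polynomial.C t) = t := fun t => by simp
  rw [hsplit]
  refine irreducible_of_wronskian hp ?_ ?_ ?_
  · rw [← Polynomial.coe_evalRingHom, map_mul, map_scaleC, map_lineVal]
    simp only [hev, a', w']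
    exact mul_ne_zero (scaleC_ne_zero p d hw) (lineVal_ne_zero hd0 s a hw h hF)
  · rw [← Polynomial.coe_evalRingHom, map_curveVal]
    simp only [hev, s', a', w']
    exact hF
  · have key := lineVal_mul_derivation (Polynomial.derivative' (R := k)) hp.pos hd s'
      (fun i => by simp [s', Polynomial.derivative']) a' w'
      (fun l => by simp [w', Polynomial.derivative']) ξ η (Polynomial.C z)
    have hder : ∀ f : k[X], Polynomial.derivative' f = derivative f := fun f => rfl
    simp only [hder] at key
    have hsc : scaleC p d w' = Polynomial.C (scaleC p d w) := by rw [map_scaleC]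
    rw [hsc, derivative_C_mul]
    intro h0
    apply hc
    have h1 : Polynomial.C (scaleC p d w) * (cuspForm p d s' a' w' ξ η *
        (η * derivative ξ - ξ * derivative η)) = 0 := by
      linear_combination h0 - Polynomial.C (scaleC p d w) * key
    exact (mul_eq_zero.1 h1).resolve_left
      (mt Polynomial.C_eq_zero.1 (scaleC_ne_zero p d hw))

/-- In the direction `[b₁ : c₁]`, where `V = 0`, only `-c g M ^ 2` survives. This certifies that the
cusp form is not identically zero. -/
theorem cuspForm_ne_zero_at_linV {p d : ℕ} (hd : 2 ≤ d)
    (s : Finset.Ioo 1 (p - 1) → k) (a : Fin (d - p - 1) → k) {w : Fin 4 → k} (hw : detW w ≠ 0)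
    (hg : slopeForm p s (w 1) (w 3) ≠ 0) : cuspForm p d s a w (w 1) (w 3) ≠ 0 := by
  have hV : linV w (w 1) (w 3) = 0 := by unfold linV; ring
  have hne : w 1 ≠ 0 ∨ w 3 ≠ 0 := by
    by_contra! h
    apply hw; rw [detW, h.1, h.2]; ring
  have hM := lineVal_ne_zero_of_linV (p := p) a hw hne hV
  rw [cuspForm, hV, zero_pow (by omega), mul_zero, zero_mul, zero_sub, neg_ne_zero]
  exact mul_ne_zero (mul_ne_zero (scaleC_ne_zero p d hw) hg) (pow_ne_zero _ hM)

theorem exists_irreducible_localEq [IsAlgClosed k] {p d : ℕ} (hp : p.Prime) [CharP k p]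
    (hd : p ≤ d) (s : Finset.Ioo 1 (p - 1) → k) (a : Fin (d - p - 1) → k) {w : Fin 4 → k}
    (hw : detW w ≠ 0) (h1 : w 1 ≠ 0) (h3 : w 3 ≠ 0) (hg : slopeForm p s (w 1) (w 3) ≠ 0)
    {x : Fin 3 → k} (h : x 0 ≠ 0 ∨ x 1 ≠ 0)
    (hF : curveVal p d s a w (x 0) (x 1) (x 2) = 0) :
    ∃ i, x i ≠ 0 ∧ Irreducible (localEq (fiberEq p d s a w) x i : MvPowerSeries (Fin 2) k) := by
  have hcusp := cuspForm_ne_zero_at_linV (hp.two_le.trans hd) s a hw hg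
  have hloc : ∀ (y : Fin 3 → MvPolynomial (Fin 2) k), aeval y (fiberEq p d s a w) =
      curveVal p d (fun i => C (s i)) (fun j => C (a j)) (fun l => C (w l)) (y 0) (y 1) (y 2) :=
    fun y => by rw [fiberEq_eq, map_curveVal]; simp [algebraMap_eq]
  have htf : ∀ t : k, toFirst (Polynomial.X + Polynomial.C t) = X 0 + C t := fun t => by
    simp [toFirst, algebraMap_eq]
  by_cases hx1 : x 1 = 0
  · have hx0 : x 0 ≠ 0 := h.resolve_right (not_not.2 hx1)
    refine ⟨0, hx0, ?_⟩
    have := irreducible_curveVal hp hd s a hw 1 (Polynomial.X + Polynomial.C (x 1 / x 0))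
      (x 2 / x 0) (by simp) ?_ ?_
    · rw [htf, map_one] at this
      rw [localEq, hloc]
      exact this
    · have := curveVal_smul hd s a w (x 0)⁻¹ (x 0) (x 1) (x 2)
      rw [hF, mul_zero] at this
      simpa [hx0, div_eq_inv_mul] using this
    · intro h0
      -- The parameter of the direction `[b₁ : c₁]` in the chart centred at `x`; this is where `b₁ ≠
      -- 0` is needed, and `c₁ ≠ 0` in the other chart.
      have := congrArg (Polynomial.evalRingHom (w 3 / w 1 - x 1 / x 0)) h0
      rw [map_mul, map_cuspForm] at this
      simp at this
      apply hcusp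
      have h2 := cuspForm_smul hp.two_le hd s a w (w 1) 1 (w 3 / w 1)
      rw [mul_one, mul_div_cancel₀ _ h1, this, mul_zero] at h2
      exact h2
  · refine ⟨1, hx1, ?_⟩
    have := irreducible_curveVal hp hd s a hw (Polynomial.X + Polynomial.C (x 0 / x 1)) 1
      (x 2 / x 1) (by simp) ?_ ?_
    · rw [htf, map_one] at this
      rw [localEq, hloc]
      exact this
    · have := curveVal_smul hd s a w (x 1)⁻¹ (x 0) (x 1) (x 2)
      rw [hF, mul_zero] at this
      simpa [hx1, div_eq_inv_mul] using this
    · intro h0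
      have := congrArg (Polynomial.evalRingHom (w 1 / w 3 - x 0 / x 1)) h0
      rw [map_mul, map_cuspForm] at this
      simp at this
      apply hcusp
      have h2 := cuspForm_smul hp.two_le hd s a w (w 3) (w 1 / w 3) 1
      rw [mul_one, mul_div_cancel₀ _ h3, this, mul_zero] at h2
      exact h2

end Fiber

/-! ### The point `[0 : 0 : 1]` -/

section Str

open MvPolynomial

variable {k : Type*} [Field k]

theorem str_rep : (str : Plane k).rep 0 = 0 ∧ (str : Plane k).rep 1 = 0 ∧
    (str : Plane k).rep 2 ≠ 0 := by
  have hne : (![0, 0, 1] : Fin 3 → k) ≠ 0 := fun h => one_ne_zero (α := k) (by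
    simpa using congrFun h 2)
  obtain ⟨t, ht⟩ := Projectivization.exists_smul_eq_mk_rep k (![0, 0, 1] : Fin 3 → k) hne
  have hs : (str : Plane k).rep = t • ![0, 0, 1] := ht.symm
  rw [hs]
  refine ⟨?_, ?_, ?_⟩ <;> simp [Units.smul_def]

theorem ne_str_iff (P : Plane k) : P ≠ str ↔ P.rep 0 ≠ 0 ∨ P.rep 1 ≠ 0 := by
  obtain ⟨h0, h1, h2⟩ := str_rep (k := k)
  constructor
  · intro h
    by_contra! hc
    apply h
    have hz : P.rep 2 ≠ 0 := fun hz => P.rep_nonzero (by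
      ext i; fin_cases i
      · exact hc.1
      · exact hc.2
      · exact hz)
    rw [← P.mk_rep, str, Projectivization.mk_eq_mk_iff']
    refine ⟨P.rep 2, ?_⟩
    ext i; fin_cases i
    · simp [hc.1]
    · simp [hc.2]
    · simp
  · rintro h rfl
    rw [h0, h1] at h
    simp at h

/-- Specializing `w` commutes with differentiation in the plane directions; hence a singular point
of the total space is singular on its fiber. -/
theorem eval_pderiv_aeval (F : FamilyRing k) (w : Fin 4 → k) (x : Fin 3 → k) (i : Fin 3) :
    eval x (pderiv i (aeval (Sum.elim X fun l => C (w l)) F : MvPolynomial (Fin 3) k)) =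
      eval (Sum.elim x w) (pderiv (.inl i) F) := by
  have h0 : ∀ F : FamilyRing k, eval x (aeval (Sum.elim X fun l => C (w l)) F :
      MvPolynomial (Fin 3) k) = eval (Sum.elim x w) F := fun F => by
    induction F using MvPolynomial.induction_on with
    | C a => simp
    | add f g hf hg => simp only [map_add, hf, hg]
    | mul_X f j hf => cases j <;> simp only [map_mul, hf, aeval_X] <;> simp
  induction F using MvPolynomial.induction_on with
  | C a => simp [algebraMap_eq]
  | add f g hf hg => simp only [map_add, hf, hg]
  | mul_X f j hf =>
    simp only [map_mul, Derivation.leibniz, map_add, smul_eq_mul, hf, h0, aeval_X]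
    cases j with
    | inl j => by_cases h : j = i <;> simp [pderiv_X, h]
    | inr j => simp [pderiv_X]

theorem isSingularAt_fiberEq_of_totalEq {p d : ℕ} {s : Finset.Ioo 1 (p - 1) → k}
    {a : Fin (d - p - 1) → k} {w : Fin 4 → k} {x : Fin 3 → k}
    (h : IsSingularAt (totalEq p d s a) (Sum.elim x w)) :
    IsSingularAt (fiberEq p d s a w) x := by
  refine ⟨?_, fun i => ?_⟩
  · rw [eval_fiberEq, ← eval_totalEq]; exact h.1
  · rw [fiberEq, eval_pderiv_aeval]; exact h.2 _

theorem sigmaForm_zero {B : Type*} [CommRing B] (p : ℕ) (s : Finset.Ioo 1 (p - 1) → B) :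
    sigmaForm p s 0 0 = 0 := by
  refine Finset.sum_eq_zero fun i hi => ?_
  rw [Finset.mem_Icc] at hi
  rw [zero_pow (by omega : i ≠ 0)]; ring

theorem curveVal_zero {p d : ℕ} (hp : 0 < p) (hde : d = p) (s : Finset.Ioo 1 (p - 1) → k)
    (a : Fin (d - p - 1) → k) (w : Fin 4 → k) (z : k) :
    curveVal p d s a w 0 0 z = scaleC p d w * z ^ p := by
  rw [curveVal, sigmaForm_zero, lineVal_of_eq p d (by omega)]
  simp [linV, show d ≠ 0 by omega]

/-- For `d = p` the curve misses the point, and for `d = p + 1` the linear term there is a nonzero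
multiple of `L₀`. -/
theorem not_isSingularAt_str {p d : ℕ} (hp : p.Prime) [CharP k p] (hd : p ≤ d) (hde : d - p ≤ 1)
    (s : Finset.Ioo 1 (p - 1) → k) (a : Fin (d - p - 1) → k) {w : Fin 4 → k} (hw : detW w ≠ 0) :
    ¬ IsSingularPoint (fiberEq p d s a w) str := by
  obtain ⟨h0, h1, h2⟩ := str_rep (k := k)
  rintro ⟨hF, hder⟩
  rcases Nat.lt_or_ge 0 (d - p) with he | he
  · have hde1 : d - p = 1 := by omega
    have hd2 : d - 1 ≠ 0 := by have := hp.two_le; omega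
    have hMu : lineValDu p d a w 0 0 = 1 := by
      have : IsEmpty (Fin (d - p - 1)) := ⟨fun j => by have := j.2; omega⟩
      simp [lineValDu, tangentFormDu, hde1]
    have hMv : lineValDv p d a w 0 0 = 0 := by
      simp [lineValDv, tangentFormDv, linU]
    have key : ∀ i, eval str.rep (pderiv i (fiberEq p d s a w)) =
        scaleC p d w * (str : Plane k).rep 2 ^ p *
          eval str.rep (pderiv i (linU (fun l => C (w l)) (X 0) (X 1))) := fun i => by
      have := congrArg (eval (str : Plane k).rep) (derivation_curveVal (pderiv i)
        (fun i => (C (s i) : MvPolynomial (Fin 3) k)) (fun i => by simp) (fun j => C (a j))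
        (fun l => C (w l)) (X 0) (X 1) (X 2))
      rw [← fiberEq_eq] at this
      rw [this]
      simp only [map_sub, map_mul, map_add, map_pow, map_natCast, map_linV, map_scaleC,
        map_slopeForm, map_sigmaForm, map_lineVal, map_lineValDu, map_lineValDv, eval_C, eval_X,
        h0, h1, hMu, hMv, sigmaForm_zero]
      simp [linV, hd2]
      ring
    have hne := mul_ne_zero (scaleC_ne_zero p d hw) (pow_ne_zero p h2)
    have e0 := key 0
    have e1 := key 1
    rw [hder] at e0 e1
    simp [linU, pderiv_X] at e0 e1
    have w2 : w 2 = 0 := by simpa [h2, scaleC_ne_zero p d hw] using e0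
    have w0 : w 0 = 0 := by simpa [h2, scaleC_ne_zero p d hw] using e1
    apply hw
    rw [detW, w2, w0]; ring
  · rw [eval_fiberEq, h0, h1, curveVal_zero hp.pos (by omega)] at hF
    exact mul_ne_zero (scaleC_ne_zero p d hw) (pow_ne_zero p h2) hF

theorem localEq_str (p d : ℕ) (s : Finset.Ioo 1 (p - 1) → k) (a : Fin (d - p - 1) → k)
    (w : Fin 4 → k) :
    localEq (fiberEq p d s a w) (str : Plane k).rep 2 =
      curveVal p d (fun i => C (s i)) (fun j => C (a j)) (fun l => C (w l)) (X 0) (X 1) 1 := by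
  obtain ⟨h0, h1, h2⟩ := str_rep (k := k)
  rw [localEq, fiberEq_eq, map_curveVal]
  simp only [aeval_X, aeval_C, algebraMap_eq]
  have e0 : Fin.insertNth (α := fun _ => MvPolynomial (Fin 2) k) 2 1
      (fun l : Fin 2 => X l + C ((str : Plane k).rep ((2 : Fin 3).succAbove l) /
        (str : Plane k).rep 2)) 0 = X 0 + C ((str : Plane k).rep 0 / (str : Plane k).rep 2) := rfl
  have e1 : Fin.insertNth (α := fun _ => MvPolynomial (Fin 2) k) 2 1
      (fun l : Fin 2 => X l + C ((str : Plane k).rep ((2 : Fin 3).succAbove l) /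
        (str : Plane k).rep 2)) 1 = X 1 + C ((str : Plane k).rep 1 / (str : Plane k).rep 2) := rfl
  have e2 : Fin.insertNth (α := fun _ => MvPolynomial (Fin 2) k) 2 1
      (fun l : Fin 2 => X l + C ((str : Plane k).rep ((2 : Fin 3).succAbove l) /
        (str : Plane k).rep 2)) 2 = 1 := rfl
  rw [e0, e1, e2, h0, h1]
  simp

/-- The lines of the tangent form, as a single family. -/
theorem tangentForm_eq_prod (e : ℕ) (α : Fin (e - 1) → k) (hα : Function.Injective α)
    (hα0 : ∀ j, α j ≠ 0) : ∃ β : Fin e → k, Function.Injective β ∧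
      ∀ {B : Type _} [CommRing B] (f : k →+* B) (u v : B),
        tangentForm e (fun j => f (α j)) u v = ∏ j, (u - f (β j) * v) := by
  cases e with
  | zero => exact ⟨Fin.elim0, fun j => j.elim0, fun f u v => by simp [tangentForm]⟩
  | succ n =>
    -- The separate factor `u` is the line `u - 0 * v`.
    refine ⟨Fin.cons 0 α, ?_, fun f u v => ?_⟩
    · rw [Fin.cons_injective_iff]
      exact ⟨fun ⟨j, hj⟩ => hα0 j hj, hα⟩
    · rw [Fin.prod_univ_succ]
      simp [tangentForm]

theorem linU_isHomogeneous (w : Fin 4 → k) :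
    (linU (fun l => C (w l)) (X 0) (X 1) : MvPolynomial (Fin 2) k).IsHomogeneous 1 :=
  (isHomogeneous_C_mul_X _ _).sub (isHomogeneous_C_mul_X _ _)

theorem linV_isHomogeneous (w : Fin 4 → k) :
    (linV (fun l => C (w l)) (X 0) (X 1) : MvPolynomial (Fin 2) k).IsHomogeneous 1 :=
  (isHomogeneous_C_mul_X _ _).sub (isHomogeneous_C_mul_X _ _)

/-- The local equation is `c M` plus a form of degree `d > d - p`. The lines of `M` are distinct
because Frobenius is injective and `L₀`, `L₁` are independent. -/
theorem isOrdinaryPoint_str {p d : ℕ} (hp : p.Prime) [CharP k p] (hd : p ≤ d)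
    (s : Finset.Ioo 1 (p - 1) → k) {a : Fin (d - p - 1) → k} (ha : Function.Injective a)
    (ha0 : ∀ j, a j ≠ 0) {w : Fin 4 → k} (hw : detW w ≠ 0) :
    IsOrdinaryPoint (fiberEq p d s a w) str (d - p) := by
  have : Fact p.Prime := ⟨hp⟩
  obtain ⟨h0, h1, h2⟩ := str_rep (k := k)
  obtain ⟨β, hβ, hprod⟩ := tangentForm_eq_prod (d - p) (fun j => a j ^ p)
    (fun i j hij => ha (frobenius_inj k p hij)) (fun j => pow_ne_zero p (ha0 j))
  set U : MvPolynomial (Fin 2) k := linU (fun l => C (w l)) (X 0) (X 1) with hU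
  set V : MvPolynomial (Fin 2) k := linV (fun l => C (w l)) (X 0) (X 1) with hV
  set M : MvPolynomial (Fin 2) k := lineVal p d (fun j => C (a j)) (fun l => C (w l)) (X 0) (X 1)
    with hM
  have hMprod : M = ∏ j, (U - C (β j) * V) := by
    rw [hM, lineVal, ← hprod C]; simp [hU, hV]
  have hMhom : M.IsHomogeneous (d - p) := by
    rw [hMprod]
    have := IsHomogeneous.prod Finset.univ (fun j => U - C (β j) * V) (fun _ => 1)
      (fun j _ => (linU_isHomogeneous w).sub (by
        simpa using (isHomogeneous_C (Fin 2) (β j)).mul (linV_isHomogeneous w)))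
    simpa using this
  have hσ : (sigmaForm p (fun i => C (s i)) (X 0) (X 1) : MvPolynomial (Fin 2) k).IsHomogeneous
      p := by
    refine IsHomogeneous.sum _ _ _ fun i hi => ?_
    rw [Finset.mem_Icc] at hi
    have hc : sigCoeff p (fun i => (C (s i) : MvPolynomial (Fin 2) k)) i = C (sigCoeff p s i) :=
      (map_sigCoeff C p s i).symm
    have := ((isHomogeneous_C (Fin 2) (sigCoeff p s i)).mul (isHomogeneous_X_pow 0 i)).mul
      (isHomogeneous_X_pow (R := k) (1 : Fin 2) (p - i))
    rw [hc]
    rwa [show 0 + i + (p - i) = p by omega] at this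
  have hsc : scaleC p d (fun l => (C (w l) : MvPolynomial (Fin 2) k)) = C (scaleC p d w) :=
    (map_scaleC C p d w).symm
  have hsplit : localEq (fiberEq p d s a w) (str : Plane k).rep 2 =
      C (scaleC p d w) * M +
        (V ^ d - C (scaleC p d w) * sigmaForm p (fun i => C (s i)) (X 0) (X 1) * M) := by
    rw [localEq_str, curveVal, hsc, one_pow]; ring
  have hlow : (C (scaleC p d w) * M).IsHomogeneous (d - p) := by
    simpa using (isHomogeneous_C (Fin 2) (scaleC p d w)).mul hMhom
  have hhigh : (V ^ d - C (scaleC p d w) * sigmaForm p (fun i => C (s i)) (X 0) (X 1) *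
      M).IsHomogeneous d := by
    refine IsHomogeneous.sub (by simpa using (linV_isHomogeneous w).pow d) ?_
    have := ((isHomogeneous_C (Fin 2) (scaleC p d w)).mul hσ).mul hMhom
    rwa [show 0 + p + (d - p) = d by omega] at this
  have hcomp : ∀ n ≤ d - p, homogeneousComponent n (localEq (fiberEq p d s a w) str.rep 2) =
      if n = d - p then C (scaleC p d w) * M else 0 := fun n hn => by
    rw [hsplit, map_add, homogeneousComponent_of_mem hlow, homogeneousComponent_of_mem hhigh,
      if_neg (show n ≠ d by have := hp.pos; omega), add_zero]
  refine ⟨2, h2, fun n hn => by rw [hcomp n hn.le, if_neg hn.ne], scaleC p d w,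
    fun j => w 2 - β j * w 3, fun j => -w 0 + β j * w 1, scaleC_ne_zero p d hw, fun j => ?_,
    fun j j' hj heq => ?_, ?_⟩
  · by_contra! hc
    apply hw
    unfold detW
    linear_combination w 1 * hc.1 + w 3 * hc.2
  · have : (β j' - β j) * detW w = 0 := by
      unfold detW; linear_combination heq
    rcases mul_eq_zero.1 this with h | h
    · exact hj (hβ (sub_eq_zero.1 h)).symm
    · exact hw h
  · rw [hcomp _ le_rfl, if_pos rfl, hMprod]
    congr 1
    refine Finset.prod_congr rfl fun j _ => ?_
    simp only [hU, hV, linU, linV, map_add, map_sub, map_mul, map_neg]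
    ring

/-- Keeps `str` out of the count of cusps when it is a singular point of the fiber. -/
theorem not_irreducible_localEq_str {p d : ℕ} (hp : p.Prime) (hde : 1 < d - p)
    (s : Finset.Ioo 1 (p - 1) → k) {a : Fin (d - p - 1) → k}
    (ha0 : ∀ j, a j ≠ 0) {w : Fin 4 → k} (hw : detW w ≠ 0) {i : Fin 3}
    (hi : (str : Plane k).rep i ≠ 0) :
    ¬ Irreducible (localEq (fiberEq p d s a w) str.rep i : MvPowerSeries (Fin 2) k) := by
  obtain ⟨h0, h1, h2⟩ := str_rep (k := k)
  have hi2 : i = 2 := by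
    fin_cases i
    · exact absurd h0 hi
    · exact absurd h1 hi
    · rfl
  subst hi2
  set U : MvPolynomial (Fin 2) k := linU (fun l => C (w l)) (X 0) (X 1) with hU
  set V : MvPolynomial (Fin 2) k := linV (fun l => C (w l)) (X 0) (X 1) with hV
  set H : MvPolynomial (Fin 2) k :=
    -(scaleC p d (fun l => C (w l)) * (sigmaForm p (fun i => C (s i)) (X 0) (X 1) - 1)) with hH
  have hsplit : localEq (fiberEq p d s a w) (str : Plane k).rep 2 =
      V ^ (d - p - 1 + 1) * V ^ p + H * (U * ∏ j, (U - C (a j ^ p) * V)) := by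
    rw [localEq_str, curveVal, lineVal, tangentForm, if_neg (by omega), ← pow_add,
      show d - p - 1 + 1 + p = d by omega]
    simp only [hU, hV, hH, one_pow, map_pow]
    ring
  have hcc : ∀ f : MvPolynomial (Fin 2) k,
      MvPowerSeries.constantCoeff (f : MvPowerSeries (Fin 2) k) = constantCoeff f := fun f => by
    rw [← MvPowerSeries.coeff_zero_eq_constantCoeff_apply, MvPolynomial.coeff_coe]; rfl
  have hU0 : constantCoeff U = 0 := by simp [hU, linU]
  have hV0 : constantCoeff V = 0 := by simp [hV, linV]
  have hH0 : constantCoeff H = scaleC p d w := by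
    rw [hH, map_neg, map_mul, map_sub, map_scaleC, map_sigmaForm]
    simp [sigmaForm_zero]
  obtain ⟨e, he, hUe⟩ : ∃ e : Fin 2 →₀ ℕ, e.degree = 1 ∧ coeff e U ≠ 0 := by
    by_cases h : w 2 = 0
    · refine ⟨Finsupp.single 1 1, by simp, ?_⟩
      have : w 0 ≠ 0 := fun h' => hw (by rw [detW, h, h']; ring)
      simpa [hU, linU, coeff_C_mul, coeff_X, Finsupp.single_left_inj] using this
    · refine ⟨Finsupp.single 0 1, by simp, ?_⟩
      simpa [hU, linU, coeff_C_mul, coeff_X, Finsupp.single_left_inj] using h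
  have := not_irreducible_of_tangents (U := (U : MvPowerSeries (Fin 2) k)) (V := V) (H := H)
    hp.pos (show 0 < d - p - 1 by omega) (fun j => a j ^ p) (fun j => pow_ne_zero p (ha0 j))
    (by rw [hcc, hU0]) (by rw [hcc, hV0]) (by rw [hcc, hH0]; exact scaleC_ne_zero p d hw) he
    (by rwa [MvPolynomial.coeff_coe])
  have hpr : ((∏ j, (U - C (a j ^ p) * V) : MvPolynomial (Fin 2) k) : MvPowerSeries (Fin 2) k) =
      ∏ j, ((U : MvPowerSeries (Fin 2) k) -
        MvPowerSeries.C (a j ^ p) * (V : MvPowerSeries (Fin 2) k)) := by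
    rw [← coeToMvPowerSeries.ringHom_apply, map_prod]
    refine Finset.prod_congr rfl fun j _ => ?_
    rw [map_sub, map_mul]
    simp only [coeToMvPowerSeries.ringHom_apply, coe_C]
  rwa [hsplit, coe_add, coe_mul, coe_pow, coe_pow, coe_mul, coe_mul, hpr]

end Str

/-! ### General members of the family -/

section General

open MvPolynomial

variable {k : Type*} [Field k]

theorem sigCoeff_one {B : Type*} [CommRing B] (p : ℕ) (s : Finset.Ioo 1 (p - 1) → B) :
    sigCoeff p s 1 = 1 := by simp [sigCoeff]

theorem sigCoeff_last {B : Type*} [CommRing B] (p : ℕ) (s : Finset.Ioo 1 (p - 1) → B) :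
    sigCoeff p s (p - 1) = 1 := by simp [sigCoeff]

theorem slopeForm_zero_one {B : Type*} [CommRing B] {p : ℕ} (hp : 2 ≤ p)
    (s : Finset.Ioo 1 (p - 1) → B) : slopeForm p s 0 1 = 1 := by
  unfold slopeForm
  rw [Finset.sum_eq_single_of_mem 1 (by rw [Finset.mem_Icc]; omega)]
  · simp [sigCoeff_one]
  · intro i hi hi1
    rw [Finset.mem_Icc] at hi
    rw [zero_pow (by omega : i - 1 ≠ 0)]; ring

theorem slopeForm_one_zero {B : Type*} [CommRing B] {p : ℕ} [CharP B p] (hp : 2 ≤ p)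
    (s : Finset.Ioo 1 (p - 1) → B) : slopeForm p s 1 0 = -1 := by
  unfold slopeForm
  rw [Finset.sum_eq_single_of_mem (p - 1) (by rw [Finset.mem_Icc]; omega)]
  · rw [sigCoeff_last, Nat.cast_sub (by omega), CharP.cast_eq_zero]; simp
  · intro i hi hi1
    rw [Finset.mem_Icc] at hi
    rw [zero_pow (by omega : p - 1 - i ≠ 0)]; ring

/-- The conditions on the parameters `w` under which the fiber is unibranch away from
`[0 : 0 : 1]`. -/
structure IsAdmissible (p : ℕ) (s : Finset.Ioo 1 (p - 1) → k) (w : Fin 4 → k) : Prop where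
  detW_ne_zero : detW w ≠ 0
  one_ne_zero : w 1 ≠ 0
  three_ne_zero : w 3 ≠ 0
  slopeForm_ne_zero : slopeForm p s (w 1) (w 3) ≠ 0

/-- A polynomial whose nonvanishing expresses admissibility. -/
def admissiblePoly {B : Type*} [CommRing B] (p : ℕ) (s : Finset.Ioo 1 (p - 1) → B)
    (w : Fin 4 → B) : B :=
  detW w * w 1 * w 3 * slopeForm p s (w 1) (w 3)

theorem isAdmissible_iff {p : ℕ} {s : Finset.Ioo 1 (p - 1) → k} {w : Fin 4 → k} :
    IsAdmissible p s w ↔ admissiblePoly p s w ≠ 0 := by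
  simp only [admissiblePoly, ne_eq, mul_eq_zero, not_or]
  exact ⟨fun h => ⟨⟨⟨h.1, h.2⟩, h.3⟩, h.4⟩, fun h => ⟨h.1.1.1, h.1.1.2, h.1.2, h.2⟩⟩

/-- A polynomial whose nonvanishing expresses that the `a j` are distinct and nonzero. -/
def distinctPoly {B : Type*} [CommRing B] {n : ℕ} (a : Fin n → B) : B :=
  (∏ j, a j) * ∏ i, ∏ j ∈ Finset.univ.erase i, (a i - a j)

theorem distinctPoly_ne_zero_iff {n : ℕ} {a : Fin n → k} :
    distinctPoly a ≠ 0 ↔ Function.Injective a ∧ ∀ j, a j ≠ 0 := by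
  simp only [distinctPoly, mul_ne_zero_iff, Finset.prod_ne_zero_iff, Finset.mem_univ, true_imp_iff,
    Finset.mem_erase, and_true, sub_ne_zero]
  constructor
  · rintro ⟨h1, h2⟩
    exact ⟨fun i j hij => by_contra fun h => h2 i j (Ne.symm h) hij, h1⟩
  · rintro ⟨h1, h2⟩
    exact ⟨h2, fun i j hij h => hij (h1 h).symm⟩

theorem distinctPoly_X_ne_zero (n : ℕ) : distinctPoly (fun j : Fin n => (X j : MvPolynomial _ k))
    ≠ 0 := by
  refine mul_ne_zero (Finset.prod_ne_zero_iff.2 fun j _ => X_ne_zero j)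
    (Finset.prod_ne_zero_iff.2 fun i _ => Finset.prod_ne_zero_iff.2 fun j hj => ?_)
  rw [sub_ne_zero]
  exact fun h => (Finset.mem_erase.1 hj).1 (X_injective h).symm

theorem eval_distinctPoly {n : ℕ} (a : Fin n → k) :
    eval a (distinctPoly fun j => X j) = distinctPoly a := by
  simp [distinctPoly, map_prod]

/-- The directions in which the differential of `σ` vanishes. -/
def slopeRoots (p : ℕ) (s : Finset.Ioo 1 (p - 1) → k) : Finset k :=
  letI := Classical.decEq k
  (slopeForm p (fun i => Polynomial.C (s i)) Polynomial.X 1).roots.toFinset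

theorem mem_slopeRoots {p : ℕ} (hp : 2 ≤ p) (s : Finset.Ioo 1 (p - 1) → k) (t : k) :
    t ∈ slopeRoots p s ↔ slopeForm p s t 1 = 0 := by
  classical
  have hev : ∀ t, (slopeForm p (fun i => Polynomial.C (s i)) Polynomial.X 1).eval t =
      slopeForm p s t 1 := fun t => by
    rw [← Polynomial.coe_evalRingHom, map_slopeForm]; simp
  have hne : slopeForm p (fun i => Polynomial.C (s i)) Polynomial.X 1 ≠ 0 := fun h => by
    have := hev 0
    rw [h, slopeForm_zero_one hp] at this
    simp at this
  rw [slopeRoots, Multiset.mem_toFinset, Polynomial.mem_roots hne, Polynomial.IsRoot, hev]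

/-- A polynomial in `w` which does not vanish for the parameters for which the total space is
smooth outside `[0 : 0 : 1]`. -/
def generalPoly (p d : ℕ) (s : Finset.Ioo 1 (p - 1) → k) (a : Fin (d - p - 1) → k) :
    MvPolynomial (Fin 4) k :=
  admissiblePoly p (fun i => C (s i)) X *
    if d - p = 0 then 1 else ∏ t ∈ slopeRoots p s, lineValDu p d (fun j => C (a j)) X (C t) 1

theorem eval_admissiblePoly (p : ℕ) (s : Finset.Ioo 1 (p - 1) → k) (w : Fin 4 → k) :
    eval w (admissiblePoly p (fun i => C (s i)) X) = admissiblePoly p s w := by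
  simp [admissiblePoly, map_detW, map_slopeForm]

theorem admissiblePoly_X_ne_zero {B : Type*} [CommRing B] [IsDomain B] {p : ℕ} (hp : 2 ≤ p)
    (s : Finset.Ioo 1 (p - 1) → B) :
    admissiblePoly p (fun i => (C (s i) : MvPolynomial (Fin 4) B)) X ≠ 0 := by
  refine mul_ne_zero (mul_ne_zero (mul_ne_zero ?_ (X_ne_zero _)) (X_ne_zero _)) ?_
  · intro h
    have := congrArg (eval ![0, 1, 1, 0]) h
    rw [map_detW] at this
    simp [detW] at this
  · intro h
    have := congrArg (eval ![0, 0, 0, 1]) h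
    rw [map_slopeForm] at this
    simp [slopeForm_zero_one hp] at this

theorem generalPoly_ne_zero {p d : ℕ} (hp : 2 ≤ p) (s : Finset.Ioo 1 (p - 1) → k)
    {a : Fin (d - p - 1) → k} (ha0 : ∀ j, a j ≠ 0) : generalPoly p d s a ≠ 0 := by
  refine mul_ne_zero (admissiblePoly_X_ne_zero hp s) ?_
  split_ifs with he
  · exact one_ne_zero
  · refine Finset.prod_ne_zero_iff.2 fun t _ h => ?_
    -- Here `U = 0` and `V = 1` at `(t, 1)` for every `t`, so `M_U = ∏ (-a j ^ p)`.
    have := congrArg (eval ![0, -1, 0, 0]) h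
    rw [map_lineValDu] at this
    simp [lineValDu, tangentFormDu, he, linU, linV, Finset.prod_eq_zero_iff, ha0] at this

theorem isCusp_of_isSingularPoint [IsAlgClosed k] {p d : ℕ} (hp : p.Prime) [CharP k p]
    (hd : p ≤ d) {s : Finset.Ioo 1 (p - 1) → k} (a : Fin (d - p - 1) → k) {w : Fin 4 → k}
    (hw : IsAdmissible p s w) {P : Plane k} (hP : P ≠ str)
    (h : IsSingularPoint (fiberEq p d s a w) P) : IsCusp (fiberEq p d s a w) P := by
  refine ⟨h, ?_⟩
  have hF := h.1
  rw [eval_fiberEq] at hF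
  exact exists_irreducible_localEq hp hd s a hw.1 hw.2 hw.3 hw.4 ((ne_str_iff P).1 hP) hF

/-- At a singular point `g = 0`, so `M_U ≠ 0` by `hgen`, hence `S = 0`. The curve equation leaves `V
= 0`, and `g` does not vanish in that direction. -/
theorem totalSmoothAt_of_general [IsAlgClosed k] {p d : ℕ} (hp : p.Prime) [CharP k p]
    (hd : p ≤ d) {s : Finset.Ioo 1 (p - 1) → k} (a : Fin (d - p - 1) → k)
    {w : Fin 4 → k} (hw : IsAdmissible p s w)
    (hgen : ∀ t, slopeForm p s t 1 = 0 → lineValDu p d a w t 1 ≠ 0) {P : Plane k} (hP : P ≠ str)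
    (hF : OnCurve (fiberEq p d s a w) P) : TotalSmoothAt p d s a P w := by
  rw [OnCurve, eval_fiberEq] at hF
  have h01 := (ne_str_iff P).1 hP
  rw [TotalSmoothAt, isSingularAt_totalEq_iff hp.pos hd s a hw.1 h01 hF]
  set x := P.rep
  rintro ⟨hg, hu, -⟩
  -- The direction `[1 : 0]` is excluded by `g(1, 0) = -1`, so the condition `hgen` on affine
  -- directions suffices.
  have hx1 : x 1 ≠ 0 := by
    intro h1
    have h0 : x 0 ≠ 0 := h01.resolve_right (not_not.2 h1)
    have := slopeForm_smul p s (x 0) 1 0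
    rw [mul_one, mul_zero, slopeForm_one_zero hp.two_le, ← h1, hg] at this
    exact pow_ne_zero (p - 2) h0 (by simpa using this.symm)
  have hx : x 0 = x 1 * (x 0 / x 1) := by field_simp
  have ht : slopeForm p s (x 0 / x 1) 1 = 0 := by
    have := slopeForm_smul p s (x 1) (x 0 / x 1) 1
    rw [← hx, mul_one, hg] at this
    exact (mul_eq_zero.1 this.symm).resolve_left (pow_ne_zero _ hx1)
  have hMu : lineValDu p d a w (x 0) (x 1) ≠ 0 := by
    have := lineValDu_smul p d a w (x 1) (x 0 / x 1) 1
    rw [← hx, mul_one] at this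
    rw [this]
    exact mul_ne_zero (pow_ne_zero _ hx1) (hgen _ ht)
  have hS := (mul_eq_zero.1 hu).resolve_right hMu
  rw [curveVal, hS, mul_zero, zero_mul, sub_zero] at hF
  have hV : linV w (x 0) (x 1) = 0 := eq_zero_of_pow_eq_zero hF
  have h3 := hw.three_ne_zero
  have hc0 : x 0 = (x 1 / w 3) * w 1 := by
    unfold linV at hV; field_simp; linear_combination hV
  have hc1 : x 1 = (x 1 / w 3) * w 3 := by field_simp
  have := slopeForm_smul p s (x 1 / w 3) (w 1) (w 3)
  rw [← hc0, ← hc1, hg] at this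
  exact mul_ne_zero (pow_ne_zero _ (div_ne_zero hx1 h3)) hw.slopeForm_ne_zero this.symm

/-- It is enough that the `a j` are distinct and nonzero, that `w` is admissible and, for `d > p`,
that `M_U ≠ 0` in the finitely many directions where `g = 0`. For `d = p` the singularity conditions
on the fiber and on the total space both reduce to `g = 0`. -/
theorem general_fiber [IsAlgClosed k] (p : ℕ) (hp : p.Prime) [CharP k p] (d : ℕ) (hd : p ≤ d)
    (s : Finset.Ioo 1 (p - 1) → k) :
    ForGeneral fun a : Fin (d - p - 1) → k =>
      ForGeneral fun w : Fin 4 → k =>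
        IsOrdinaryPoint (fiberEq p d s a w) str (d - p) ∧
        (∀ P, IsSingularPoint (fiberEq p d s a w) P → P ≠ str → IsCusp (fiberEq p d s a w) P) ∧
        (d - p = 0 → ∀ P, OnCurve (fiberEq p d s a w) P →
          (¬ TotalSmoothAt p d s a P w ↔ IsCusp (fiberEq p d s a w) P)) ∧
        (d - p = 1 → ∀ P, OnCurve (fiberEq p d s a w) P → TotalSmoothAt p d s a P w) ∧
        (1 < d - p → ∀ P, OnCurve (fiberEq p d s a w) P → P ≠ str →
          TotalSmoothAt p d s a P w) := by
  refine ⟨distinctPoly fun j => X j, distinctPoly_X_ne_zero _, fun a ha => ?_⟩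
  rw [eval_distinctPoly, distinctPoly_ne_zero_iff] at ha
  refine ⟨generalPoly p d s a, generalPoly_ne_zero hp.two_le s ha.2, fun w hw => ?_⟩
  rw [generalPoly, map_mul, mul_ne_zero_iff, eval_admissiblePoly, ← isAdmissible_iff] at hw
  obtain ⟨hw, hgen⟩ := hw
  have hgen' : d - p ≠ 0 → ∀ t, slopeForm p s t 1 = 0 → lineValDu p d a w t 1 ≠ 0 := by
    intro he t ht
    rw [if_neg he, map_prod, Finset.prod_ne_zero_iff] at hgen
    have := hgen t ((mem_slopeRoots hp.two_le s t).2 ht)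
    rw [map_lineValDu] at this
    simpa using this
  refine ⟨isOrdinaryPoint_str hp hd s ha.1 ha.2 hw.1,
    fun P hsing hP => isCusp_of_isSingularPoint hp hd a hw hP hsing, fun he P hF => ?_,
    fun he P hF => ?_, fun he P hF hP => totalSmoothAt_of_general hp hd a hw
      (hgen' (by omega)) hP hF⟩
  · rw [OnCurve, eval_fiberEq] at hF
    have hP : P ≠ str := by
      rintro rfl
      obtain ⟨h0, h1, h2⟩ := str_rep (k := k)
      rw [h0, h1, curveVal_zero hp.pos (by omega)] at hF
      exact mul_ne_zero (scaleC_ne_zero p d hw.1) (pow_ne_zero p h2) hF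
    have h01 := (ne_str_iff P).1 hP
    rw [TotalSmoothAt, not_not]
    refine ⟨fun h => isCusp_of_isSingularPoint hp hd a hw hP
      (isSingularAt_fiberEq_of_totalEq h), fun h => ?_⟩
    have hc := ((isSingularAt_fiberEq_iff hp.pos hd s a hw.1 h01).1 h.1).2
    rw [cuspForm, lineValDu_of_eq p d he, lineVal_of_eq p d he, mul_zero, zero_sub, one_pow,
      mul_one, neg_eq_zero] at hc
    rw [isSingularAt_totalEq_iff hp.pos hd s a hw.1 h01 hF, lineValDu_of_eq p d he,
      lineValDv_of_eq p d he]
    refine ⟨(mul_eq_zero.1 hc).resolve_left (scaleC_ne_zero p d hw.1), mul_zero _, ?_⟩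
    rw [show d = p by omega, CharP.cast_eq_zero]; ring
  · by_cases hP : P = str
    · subst hP
      exact fun h => not_isSingularAt_str hp hd he.le s a hw.1 (isSingularAt_fiberEq_of_totalEq h)
    · exact totalSmoothAt_of_general hp hd a hw (hgen' (by omega)) hP hF

end General

/-! ### Cusps as roots of a polynomial -/

section Cusps

open Polynomial

variable {k : Type*} [Field k]

/-- The dehomogenized cusp form. -/
def cuspPoly {B : Type*} [CommRing B] (p d : ℕ) (s : Finset.Ioo 1 (p - 1) → B)
    (a : Fin (d - p - 1) → B) (w : Fin 4 → B) : B[X] :=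
  cuspForm p d (fun i => C (s i)) (fun j => C (a j)) (fun l => C (w l)) X 1

theorem eval_cuspPoly {B : Type*} [CommRing B] (p d : ℕ) (s : Finset.Ioo 1 (p - 1) → B)
    (a : Fin (d - p - 1) → B) (w : Fin 4 → B) (t : B) :
    (cuspPoly p d s a w).eval t = cuspForm p d s a w t 1 := by
  rw [cuspPoly, ← coe_evalRingHom, map_cuspForm]; simp

/-- The form has only simple zeros, and every linear factor has coefficient one in `u`, so the
derivative in `u` alone detects this. -/
theorem tangentFormDu_ne_zero {e : ℕ} {α : Fin (e - 1) → k} (hα : Function.Injective α)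
    (hα0 : ∀ j, α j ≠ 0) {u v : k} (h : u ≠ 0 ∨ v ≠ 0) (h0 : tangentForm e α u v = 0) :
    tangentFormDu e α u v ≠ 0 := by
  unfold tangentForm at h0
  unfold tangentFormDu
  split_ifs at h0 ⊢ with he
  · exact absurd h0 one_ne_zero
  · by_cases hu : u = 0
    · subst hu
      have hv : v ≠ 0 := h.resolve_left (not_not.2 rfl)
      simp [Finset.prod_eq_zero_iff, hα0, hv]
    · have h1 := (mul_eq_zero.1 h0).resolve_left hu
      obtain ⟨j, -, hj⟩ := Finset.prod_eq_zero_iff.1 h1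
      have hv : v ≠ 0 := by rintro rfl; simp [hu] at hj
      rw [h1, zero_add]
      refine mul_ne_zero hu ?_
      rw [Finset.sum_eq_single j]
      · refine Finset.prod_ne_zero_iff.2 fun i hi h => ?_
        have : (α j - α i) * v = 0 := by linear_combination h - hj
        exact Finset.ne_of_mem_erase hi
          (hα (sub_eq_zero.1 ((mul_eq_zero.1 this).resolve_right hv))).symm
      · intro i _ hij
        exact Finset.prod_eq_zero (Finset.mem_erase.2 ⟨hij.symm, Finset.mem_univ j⟩) hj
      · simp

variable {p d : ℕ} {s : Finset.Ioo 1 (p - 1) → k} {a : Fin (d - p - 1) → k} {w : Fin 4 → k}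

theorem lineValDu_ne_zero (hp : p.Prime) [CharP k p] (ha : Function.Injective a)
    (ha0 : ∀ j, a j ≠ 0) (hw : detW w ≠ 0) {x y : k} (h : x ≠ 0 ∨ y ≠ 0)
    (hM : lineVal p d a w x y = 0) : lineValDu p d a w x y ≠ 0 := by
  have : Fact p.Prime := ⟨hp⟩
  refine tangentFormDu_ne_zero (fun i j hij => ha (frobenius_inj k p hij))
    (fun j => pow_ne_zero p (ha0 j)) ?_ hM
  by_contra! hc
  exact linUV_ne_zero hw h hc.2 hc.1

/-- Where `M = 0` the cusp form is `π V ^ (d - 1) M_U`, with all factors nonzero. So the curve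
equation can be solved for `z ^ p` at every zero of the cusp form. -/
theorem lineVal_ne_zero_of_cuspForm (hp : p.Prime) [CharP k p] (ha : Function.Injective a)
    (ha0 : ∀ j, a j ≠ 0) (hw : detW w ≠ 0) {x y : k} (h : x ≠ 0 ∨ y ≠ 0)
    (hc : cuspForm p d s a w x y = 0) : lineVal p d a w x y ≠ 0 := by
  intro hM
  have hV : linV w x y ≠ 0 := fun hV => lineVal_ne_zero_of_linV a hw h hV hM
  rw [cuspForm, hM, zero_pow two_ne_zero, mul_zero, sub_zero] at hc
  exact mul_ne_zero (mul_ne_zero hw (pow_ne_zero _ hV)) (lineValDu_ne_zero hp ha ha0 hw h hM) hc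

theorem isCusp_iff [IsAlgClosed k] (hp : p.Prime) [CharP k p] (hd : p ≤ d) (ha0 : ∀ j, a j ≠ 0)
    (hw : IsAdmissible p s w) (P : Plane k) :
    IsCusp (fiberEq p d s a w) P ↔ (P.rep 0 ≠ 0 ∨ P.rep 1 ≠ 0) ∧
      curveVal p d s a w (P.rep 0) (P.rep 1) (P.rep 2) = 0 ∧
      cuspForm p d s a w (P.rep 0) (P.rep 1) = 0 := by
  constructor
  · intro h
    have hP : P ≠ str := by
      rintro rfl
      rcases Nat.lt_or_ge 1 (d - p) with he | he
      · obtain ⟨i, hi, hirr⟩ := h.2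
        exact not_irreducible_localEq_str hp he s ha0 hw.1 hi hirr
      · exact not_isSingularAt_str hp hd he s a hw.1 h.1
    have h01 := (ne_str_iff P).1 hP
    exact ⟨h01, (isSingularAt_fiberEq_iff hp.pos hd s a hw.1 h01).1 h.1⟩
  · rintro ⟨h01, h⟩
    exact isCusp_of_isSingularPoint hp hd a hw ((ne_str_iff P).2 h01)
      ((isSingularAt_fiberEq_iff hp.pos hd s a hw.1 h01).2 h)

/-- By `hinf` no cusp has direction `[1 : 0]`. Over each root `t` the equation determines `z ^ p`,
hence `z`. -/
theorem encard_isCusp [IsAlgClosed k] [DecidableEq k] (hp : p.Prime) [CharP k p] (hd : p ≤ d)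
    (ha : Function.Injective a) (ha0 : ∀ j, a j ≠ 0) (hw : IsAdmissible p s w)
    (hinf : cuspForm p d s a w 1 0 ≠ 0) (hR : cuspPoly p d s a w ≠ 0) :
    {P | IsCusp (fiberEq p d s a w) P}.encard = (cuspPoly p d s a w).roots.toFinset.card := by
  have : Fact p.Prime := ⟨hp⟩
  -- Where `M = 0` the quotient takes the default value `0`; this is harmless, since `y t` is used
  -- only at roots, where `M ≠ 0`.
  have hex : ∀ t : k, ∃ y : k, y ^ p =
      sigmaForm p s t 1 - linV w t 1 ^ d / (scaleC p d w * lineVal p d a w t 1) := fun t =>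
    IsAlgClosed.exists_pow_nat_eq _ hp.pos
  choose y hy using hex
  have hvec : ∀ t z : k, (![t, 1, z] : Fin 3 → k) ≠ 0 := fun t z h => by simpa using congrFun h 1
  set f : k → Plane k := fun t => Projectivization.mk k ![t, 1, y t] (hvec _ _) with hf
  have hroot : ∀ t, t ∈ (cuspPoly p d s a w).roots.toFinset ↔ cuspForm p d s a w t 1 = 0 :=
    fun t => by rw [Multiset.mem_toFinset, mem_roots hR, IsRoot, eval_cuspPoly]
  have hinj : Function.Injective f := by
    intro t t' htt
    obtain ⟨l, hl⟩ := (Projectivization.mk_eq_mk_iff' k _ _ (hvec _ _) (hvec _ _)).1 htt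
    have h0 := congrFun hl 0
    have h1 := congrFun hl 1
    simp at h0 h1
    rw [h1] at h0
    simpa using h0.symm
  have hyF : ∀ t z : k, lineVal p d a w t 1 ≠ 0 →
      (curveVal p d s a w t 1 z = 0 ↔ z = y t) := fun t z hM => by
    have hcM := mul_ne_zero (scaleC_ne_zero p d hw.1) hM
    rw [← (frobenius_inj k p).eq_iff (b := y t), frobenius_def, frobenius_def, hy, curveVal,
      eq_sub_iff_add_eq, ← eq_sub_iff_add_eq', div_eq_iff hcM, sub_eq_zero]
    refine ⟨fun h => ?_, fun h => ?_⟩ <;> linear_combination h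
  have himage : {P | IsCusp (fiberEq p d s a w) P} =
      f '' ((cuspPoly p d s a w).roots.toFinset : Set k) := by
    ext P
    rw [Set.mem_ofPred_eq, isCusp_iff hp hd ha0 hw, Set.mem_image]
    constructor
    · rintro ⟨h01, hF, hc⟩
      set x := P.rep with hx
      have hx1 : x 1 ≠ 0 := by
        intro h1
        have h0 : x 0 ≠ 0 := h01.resolve_right (not_not.2 h1)
        have := cuspForm_smul hp.two_le hd s a w (x 0) 1 0
        rw [mul_one, mul_zero, ← h1, hc, h1] at this
        exact mul_ne_zero (pow_ne_zero _ h0) hinf this.symm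
      have hx0 : x 1 * (x 0 / x 1) = x 0 := by field_simp
      have hx2 : x 1 * (x 2 / x 1) = x 2 := by field_simp
      have hc' : cuspForm p d s a w (x 0 / x 1) 1 = 0 := by
        have := cuspForm_smul hp.two_le hd s a w (x 1) (x 0 / x 1) 1
        rw [hx0, mul_one, hc] at this
        exact (mul_eq_zero.1 this.symm).resolve_left (pow_ne_zero _ hx1)
      have hF' : curveVal p d s a w (x 0 / x 1) 1 (x 2 / x 1) = 0 := by
        have := curveVal_smul hd s a w (x 1) (x 0 / x 1) 1 (x 2 / x 1)
        rw [hx0, hx2, mul_one, hF] at this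
        exact (mul_eq_zero.1 this.symm).resolve_left (pow_ne_zero _ hx1)
      refine ⟨x 0 / x 1, (hroot _).2 hc', ?_⟩
      have hM := lineVal_ne_zero_of_cuspForm hp ha ha0 hw.1 (Or.inr one_ne_zero) hc'
      have hy2 := (hyF _ _ hM).1 hF'
      rw [hf, ← P.mk_rep]
      simp only
      rw [Projectivization.mk_eq_mk_iff']
      refine ⟨(x 1)⁻¹, ?_⟩
      rw [← hx, ← hy2]
      ext i; fin_cases i
      · simp [div_eq_inv_mul]
      · simp [hx1]
      · simp [div_eq_inv_mul]
    · rintro ⟨t, ht, rfl⟩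
      have hc := (hroot t).1 ht
      have hM := lineVal_ne_zero_of_cuspForm hp ha ha0 hw.1 (Or.inr one_ne_zero) hc
      obtain ⟨l, hl⟩ := Projectivization.exists_smul_eq_mk_rep k ![t, 1, y t] (hvec _ _)
      have h0 : (f t).rep 0 = l * t := by rw [hf]; simp only; rw [← hl]; simp [Units.smul_def]
      have h1 : (f t).rep 1 = l * 1 := by rw [hf]; simp only; rw [← hl]; simp [Units.smul_def]
      have h2 : (f t).rep 2 = l * y t := by rw [hf]; simp only; rw [← hl]; simp [Units.smul_def]
      rw [h0, h1, h2, curveVal_smul hd, cuspForm_smul hp.two_le hd, hc, (hyF t _ hM).2 rfl]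
      simp
  rw [himage, hinj.encard_image, Set.encard_coe_eq_coe_finsetCard]

/-! ### Numbers of roots -/

theorem isCoprime_of_no_common_root [IsAlgClosed k] {f g : k[X]} (hf : f ≠ 0)
    (h : ∀ r, f.eval r = 0 → g.eval r ≠ 0) : IsCoprime f g := by
  refine isCoprime_of_irreducible_dvd (fun h0 => hf h0.1) fun z hz hzf hzg => ?_
  obtain ⟨r, hr⟩ := IsAlgClosed.exists_root z (degree_pos_of_irreducible hz).ne'
  exact h r (eval_eq_zero_of_dvd_of_eval_eq_zero hzf hr)
    (eval_eq_zero_of_dvd_of_eval_eq_zero hzg hr)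

theorem eval_ne_zero_of_isCoprime {f g : k[X]} (h : IsCoprime f g) {r : k} (hf : f.eval r = 0) :
    g.eval r ≠ 0 := by
  intro hg
  obtain ⟨u, v, huv⟩ := h
  have := congrArg (eval r) huv
  simp [hf, hg] at this

theorem card_roots_of_isCoprime_derivative [IsAlgClosed k] [DecidableEq k] {f : k[X]}
    (h : IsCoprime f (derivative f)) : f.roots.toFinset.card = f.natDegree := by
  rw [Multiset.toFinset_card_of_nodup (nodup_roots (p := f) h),
    (IsAlgClosed.splits f).natDegree_eq_card_roots]

/-- If `f' = 0` in characteristic two, all roots are at least double; they are exactly double if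
`f` and its second Hasse derivative are coprime. -/
theorem card_roots_of_isCoprime_hasseDeriv [IsAlgClosed k] [DecidableEq k] {f : k[X]}
    (hf : f ≠ 0) (h : IsCoprime f (hasseDeriv 2 f)) (h1 : derivative f = 0) :
    2 * f.roots.toFinset.card = f.natDegree := by
  have hm : ∀ r ∈ f.roots.toFinset, f.roots.count r = 2 := fun r hr => by
    rw [Multiset.mem_toFinset, mem_roots hf] at hr
    rw [count_roots]
    refine le_antisymm ?_ ((one_lt_rootMultiplicity_iff_isRoot hf).2 ⟨hr, by simp [h1]⟩)
    by_contra! hlt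
    have hdvd : (X - C r) ^ 3 ∣ f := (le_rootMultiplicity_iff hf).1 hlt
    obtain ⟨q, hq⟩ := hdvd
    apply eval_ne_zero_of_isCoprime h hr
    -- The second Hasse derivative at `r` is the second Taylor coefficient, which vanishes at a root
    -- of multiplicity three.
    rw [← taylor_coeff, hq, taylor_mul, taylor_pow, map_sub, taylor_X, taylor_C, add_sub_cancel_right,
      coeff_X_pow_mul']
    simp
  rw [(IsAlgClosed.splits f).natDegree_eq_card_roots, ← Multiset.toFinset_sum_count_eq,
    Finset.sum_congr rfl hm, Finset.sum_const, smul_eq_mul, mul_comm]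

/-- The resultant is taken in fixed formal degrees so that it is a polynomial in the coefficients
and commutes with specialization. The price is the condition on the top coefficient of `f`. -/
theorem isCoprime_of_resultant_ne_zero {f g : k[X]} {N : ℕ} (hf : f.natDegree ≤ N)
    (hg : g.natDegree ≤ N) (hN : f.coeff N ≠ 0) (h : resultant f g N N ≠ 0) : IsCoprime f g := by
  rcases Nat.eq_zero_or_pos N with rfl | hpos
  · rw [eq_C_of_natDegree_le_zero hf]
    exact ⟨C (f.coeff 0)⁻¹, 0, by rw [← C_mul, inv_mul_cancel₀ hN]; simp⟩
  · obtain ⟨u, v, -, -, huv⟩ := exists_mul_add_mul_eq_C_resultant f g hf hg (Or.inl hpos.ne')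
    refine ⟨C (resultant f g N N)⁻¹ * u, C (resultant f g N N)⁻¹ * v, ?_⟩
    have : C (resultant f g N N)⁻¹ * C (resultant f g N N) = 1 := by
      rw [← C_mul, inv_mul_cancel₀ h, C_1]
    linear_combination C (resultant f g N N)⁻¹ * huv + this

theorem resultant_ne_zero_of_isCoprime {f g : k[X]} {N : ℕ} (hf : f.natDegree ≤ N)
    (hg : g.natDegree ≤ N) (hN : f.coeff N ≠ 0) (h : IsCoprime f g) :
    resultant f g N N ≠ 0 := by
  obtain ⟨m, hm⟩ := Nat.exists_eq_add_of_le hg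
  have hfN : f.natDegree = N := le_antisymm hf (le_natDegree_of_ne_zero hN)
  -- Padding the formal degree of `g` only multiplies by powers of the top coefficient of `f`.
  have : resultant f g N N = f.coeff N ^ m * resultant f g N g.natDegree := by
    conv_lhs => rw [hm]
    rw [resultant_add_right_deg _ _ _ _ _ le_rfl, ← hm]
  rw [this]
  refine mul_ne_zero (pow_ne_zero _ hN) ?_
  have := resultant_ne_zero f g h
  rwa [hfN] at this

end Cusps

/-! ### The degree of the cusp polynomial -/

section Degree

open Polynomial

variable {B : Type*} [CommRing B]

/-- `f` has degree at most `n`, and `c` is its coefficient of degree `n`. -/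
def HasTop (n : ℕ) (f : B[X]) (c : B) : Prop := f.natDegree ≤ n ∧ f.coeff n = c

theorem HasTop.mul {m n : ℕ} {f g : B[X]} {b c : B} (hf : HasTop m f b) (hg : HasTop n g c) :
    HasTop (m + n) (f * g) (b * c) :=
  ⟨natDegree_mul_le_of_le hf.1 hg.1, by
    rw [coeff_mul_add_eq_of_natDegree_le hf.1 hg.1, hf.2, hg.2]⟩

theorem HasTop.add {n : ℕ} {f g : B[X]} {b c : B} (hf : HasTop n f b) (hg : HasTop n g c) :
    HasTop n (f + g) (b + c) :=
  ⟨(natDegree_add_le _ _).trans (max_le hf.1 hg.1), by rw [coeff_add, hf.2, hg.2]⟩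

theorem HasTop.sub {n : ℕ} {f g : B[X]} {b c : B} (hf : HasTop n f b) (hg : HasTop n g c) :
    HasTop n (f - g) (b - c) :=
  ⟨(natDegree_sub_le _ _).trans (max_le hf.1 hg.1), by rw [coeff_sub, hf.2, hg.2]⟩

theorem HasTop.pow {n : ℕ} {f : B[X]} {c : B} (hf : HasTop n f c) (m : ℕ) :
    HasTop (m * n) (f ^ m) (c ^ m) :=
  ⟨natDegree_pow_le_of_le m hf.1, by rw [coeff_pow_of_natDegree_le hf.1, hf.2]⟩

theorem hasTop_C (c : B) : HasTop 0 (C c) c := ⟨by simp, by simp⟩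

theorem HasTop.sum {n : ℕ} {ι : Type*} {S : Finset ι} {f : ι → B[X]} {c : ι → B}
    (h : ∀ i ∈ S, HasTop n (f i) (c i)) : HasTop n (∑ i ∈ S, f i) (∑ i ∈ S, c i) :=
  ⟨natDegree_sum_le_of_forall_le _ _ fun i hi => (h i hi).1, by
    rw [finsetSum_coeff]; exact Finset.sum_congr rfl fun i hi => (h i hi).2⟩

theorem HasTop.prod {ι : Type*} {S : Finset ι} {f : ι → B[X]} {c : ι → B}
    (h : ∀ i ∈ S, HasTop 1 (f i) (c i)) : HasTop S.card (∏ i ∈ S, f i) (∏ i ∈ S, c i) := by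
  classical
  induction S using Finset.induction_on with
  | empty => simpa using hasTop_C (1 : B)
  | insert i S hi ih =>
    rw [Finset.prod_insert hi, Finset.prod_insert hi, Finset.card_insert_of_notMem hi, add_comm]
    exact (h i (Finset.mem_insert_self i S)).mul
      (ih fun j hj => h j (Finset.mem_insert_of_mem hj))

variable {p d : ℕ} (s : Finset.Ioo 1 (p - 1) → B) (a : Fin (d - p - 1) → B) (w : Fin 4 → B)

/-- The top coefficient is left unsimplified to match the value of the linear form at `(1, 0)`. The
same holds below: the top coefficient of a form dehomogenized at `y = 1` is its value at `(1, 0)`.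
-/
theorem hasTop_linear (b c : B) : HasTop 1 (C b * X - C c * 1) (b * 1 - c * 0) := by
  refine ⟨?_, ?_⟩
  · rw [mul_one]
    exact (natDegree_sub_le _ _).trans (max_le ((natDegree_C_mul_le _ _).trans natDegree_X_le) (by simp))
  · simp [coeff_C]

theorem hasTop_slopeForm (hp : 2 ≤ p) :
    HasTop (p - 2) (slopeForm p (fun i => C (s i)) X 1) (slopeForm p s 1 0) := by
  refine HasTop.sum fun i hi => ?_
  rw [Finset.mem_Icc] at hi
  have h1 : HasTop (p - 2) (X ^ (i - 1) : B[X]) (1 ^ (i - 1) * 0 ^ (p - 1 - i)) := by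
    refine ⟨(natDegree_X_pow_le _).trans (by omega), ?_⟩
    rw [coeff_X_pow]
    by_cases h : i = p - 1
    · rw [if_pos (by omega), show p - 1 - i = 0 by omega]; simp
    · rw [if_neg (by omega), zero_pow (by omega)]; simp
  have := (hasTop_C ((i : B) * sigCoeff p s i)).mul h1
  rw [zero_add] at this
  have hc : sigCoeff p (fun i => (C (s i) : B[X])) i = C (sigCoeff p s i) :=
    (map_sigCoeff C p s i).symm
  rw [hc, one_pow, mul_one]
  simpa [mul_assoc] using this

theorem hasTop_factor (α : Fin (d - p - 1) → B) (j : Fin (d - p - 1)) :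
    HasTop 1 (linU (fun l => C (w l)) X 1 - C (α j) * linV (fun l => C (w l)) X 1)
      (linU w 1 0 - α j * linV w 1 0) := by
  have := (hasTop_linear (w 2) (w 0)).sub
    ((hasTop_C (α j)).mul (hasTop_linear (w 3) (w 1)))
  simpa [linU, linV] using this

theorem hasTop_lineVal :
    HasTop (d - p) (lineVal p d (fun j => C (a j)) (fun l => C (w l)) X 1)
      (lineVal p d a w 1 0) := by
  unfold lineVal tangentForm
  split_ifs with h
  · rw [h]; simpa using hasTop_C (1 : B)
  · have h1 := HasTop.prod (S := Finset.univ) fun j _ => hasTop_factor w (fun j => a j ^ p) j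
    have h2 := (hasTop_linear (w 2) (w 0)).mul h1
    rw [Finset.card_univ, Fintype.card_fin, show 1 + (d - p - 1) = d - p by omega] at h2
    simpa [linU, linV] using h2

theorem hasTop_lineValDu :
    HasTop (d - p - 1) (lineValDu p d (fun j => C (a j)) (fun l => C (w l)) X 1)
      (lineValDu p d a w 1 0) := by
  unfold lineValDu tangentFormDu
  split_ifs with h
  · exact ⟨by simp, by simp⟩
  · have h1 := HasTop.prod (S := Finset.univ) fun j _ => hasTop_factor w (fun j => a j ^ p) j
    have h2 : ∀ j, HasTop (d - p - 1 - 1) (∏ i ∈ Finset.univ.erase j,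
        (linU (fun l => C (w l)) X 1 - C (a i ^ p) * linV (fun l => C (w l)) X 1))
        (∏ i ∈ Finset.univ.erase j, (linU w 1 0 - a i ^ p * linV w 1 0)) := fun j => by
      have := HasTop.prod (S := Finset.univ.erase j) fun i _ =>
        hasTop_factor w (fun j => a j ^ p) i
      rwa [Finset.card_erase_of_mem (Finset.mem_univ j), Finset.card_univ,
        Fintype.card_fin] at this
    rw [Finset.card_univ, Fintype.card_fin] at h1
    simp only [C_pow] at h1 h2
    refine h1.add ?_
    rcases Nat.eq_zero_or_pos (d - p - 1) with h0 | h0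
    · have : IsEmpty (Fin (d - p - 1)) := ⟨fun j => by have := j.2; omega⟩
      simp only [Finset.univ_eq_empty, Finset.sum_empty, mul_zero]
      exact ⟨by simp, by simp⟩
    · have h3 := (hasTop_linear (w 2) (w 0)).mul (HasTop.sum (S := Finset.univ) fun j _ => h2 j)
      rw [show 1 + (d - p - 1 - 1) = d - p - 1 by omega] at h3
      exact h3

theorem hasTop_cuspPoly (hp : 2 ≤ p) (hd : p ≤ d) :
    HasTop (2 * d - p - 2) (cuspPoly p d s a w) (cuspForm p d s a w 1 0) := by
  have hdet : detW (fun l => (C (w l) : B[X])) = C (detW w) := (map_detW C w).symm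
  have hsc : scaleC p d (fun l => (C (w l) : B[X])) = C (scaleC p d w) := (map_scaleC C p d w).symm
  unfold cuspPoly cuspForm
  rw [hdet, hsc]
  refine HasTop.sub ?_ ?_
  · by_cases he : d - p = 0
    · simp only [lineValDu_of_eq p d he, mul_zero]
      exact ⟨by simp, by simp⟩
    · have := ((hasTop_C (detW w)).mul ((hasTop_linear (w 3) (w 1)).pow (d - 1))).mul
        (hasTop_lineValDu (p := p) a w)
      rw [show 0 + (d - 1) * 1 + (d - p - 1) = 2 * d - p - 2 by omega] at this
      exact this
  · have := ((hasTop_C (scaleC p d w)).mul (hasTop_slopeForm s hp)).mul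
      ((hasTop_lineVal (p := p) a w).pow 2)
    rw [show 0 + (p - 2) + 2 * (d - p) = 2 * d - p - 2 by omega] at this
    exact this

end Degree

/-! ### Characteristic two -/

section CharTwo

open Polynomial

theorem derivative_derivative_of_charTwo {B : Type*} [CommRing B] [CharP B 2] (f : B[X]) :
    derivative (derivative f) = 0 := by
  have := congrFun (factorial_smul_hasseDeriv (R := B) 2) f
  simp only [Nat.factorial_two, Function.iterate_succ, Function.iterate_zero, Function.comp_apply,
    id] at this
  rw [← this, LinearMap.smul_apply, nsmul_eq_mul, CharP.cast_eq_zero, zero_mul]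

theorem slopeForm_two {B : Type*} [CommRing B] {p : ℕ} (hp : p = 2)
    (s : Finset.Ioo 1 (p - 1) → B) (x y : B) : slopeForm p s x y = 1 := by
  subst hp
  simp [slopeForm, sigCoeff]

/-- For `p = 2` one has `g = 1`, and the fundamental identity gives `R = M (V ^ d)' - V ^ d M' - c M
^ 2`. Second derivatives and derivatives of squares vanish, and the two products of first
derivatives cancel. -/
theorem derivative_cuspPoly {k : Type*} [Field k] {p d : ℕ} (hp : p = 2) [CharP k p] (hd : p ≤ d)
    (s : Finset.Ioo 1 (p - 1) → k) (a : Fin (d - p - 1) → k) (w : Fin 4 → k) :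
    derivative (cuspPoly p d s a w) = 0 := by
  subst hp
  set s' : Finset.Ioo 1 (2 - 1) → k[X] := fun i => C (s i)
  set a' : Fin (d - 2 - 1) → k[X] := fun j => C (a j)
  set w' : Fin 4 → k[X] := fun l => C (w l)
  have hs : ∀ i, derivative' (s' i) = 0 := fun i => by simp [s', derivative']
  have hw : ∀ l, derivative' (w' l) = 0 := fun l => by simp [w', derivative']
  have key := lineVal_mul_derivation derivative' (by omega) hd s' hs a' w' hw X 1 0
  have hσ := derivation_sigmaForm derivative' s' hs X 1
  have hder : ∀ f : k[X], derivative' f = derivative f := fun f => rfl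
  have hc : derivative (scaleC 2 d w') = 0 := by
    rw [← map_scaleC C 2 d w, derivative_C]
  rw [slopeForm_two rfl] at hσ
  simp only [hder] at key hσ
  simp only [curveVal, derivative_sub, derivative_mul, hc, hσ, zero_pow two_ne_zero,
    sub_zero, derivative_X, derivative_one] at key
  have hR : cuspPoly 2 d s a w = lineVal 2 d a' w' X 1 * derivative (linV w' X 1 ^ d) -
      linV w' X 1 ^ d * derivative (lineVal 2 d a' w' X 1) -
      scaleC 2 d w' * lineVal 2 d a' w' X 1 ^ 2 := by
    rw [cuspPoly]
    linear_combination -key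
  have h2 : derivative (lineVal 2 d a' w' X 1 ^ 2) = 0 := by
    rw [derivative_sq, CharTwo.two_eq_zero, C_0]; ring
  rw [hR, derivative_sub, derivative_sub, derivative_mul, derivative_mul, derivative_mul, hc, h2,
    derivative_derivative_of_charTwo, derivative_derivative_of_charTwo]
  ring

end CharTwo

/-! ### A member of the family with the maximal number of cusps -/

section Pencil

open Polynomial

variable {k : Type*} [Field k]

/-- In a pencil without base points, almost all members have no root in common with their
Hasse derivative. -/
theorem exists_finset_pencil (m : ℕ) {P Q : k[X]}
    (hPQ : ∀ r, Q.eval r = 0 → P.eval r ≠ 0)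
    (hW : P * hasseDeriv m Q - hasseDeriv m P * Q ≠ 0) :
    ∃ S : Finset k, ∀ l ∉ S, ∀ r, (P + C l * Q).eval r = 0 →
      (hasseDeriv m (P + C l * Q)).eval r ≠ 0 := by
  classical
  -- A common root `r` is a root of this Wronskian, and `l = -P(r) / Q(r)` because `Q(r) ≠ 0`.
  refine ⟨(P * hasseDeriv m Q - hasseDeriv m P * Q).roots.toFinset.image
    fun r => -(P.eval r) / Q.eval r, fun l hl r h0 h1 => hl ?_⟩
  rw [← smul_eq_C_mul, map_add, map_smul] at h1
  simp only [eval_add, eval_mul, eval_C, eval_smul, smul_eq_mul] at h0 h1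
  have hQ : Q.eval r ≠ 0 := fun hQ => hPQ r hQ (by simpa [hQ] using h0)
  refine Finset.mem_image.2 ⟨r, ?_, ?_⟩
  · rw [Multiset.mem_toFinset, mem_roots hW, IsRoot]
    simp only [eval_sub, eval_mul]
    linear_combination (hasseDeriv m Q).eval r * h0 - Q.eval r * h1
  · rw [div_eq_iff hQ]
    linear_combination -h0

theorem eval_hasseDeriv_two_sq {f : k[X]} {r : k} (h : f.eval r = 0) :
    (hasseDeriv 2 (f ^ 2)).eval r = ((derivative f).eval r) ^ 2 := by
  rw [← taylor_coeff, taylor_pow, pow_two, coeff_mul,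
    Finset.Nat.sum_antidiagonal_eq_sum_range_succ_mk]
  simp [Finset.sum_range_succ, taylor_coeff_zero, taylor_coeff_one, h]
  ring

theorem slopeForm_of_forall_eq_zero {B : Type*} [CommRing B] {p : ℕ} [CharP B p] (hp : 2 < p)
    {s : Finset.Ioo 1 (p - 1) → B} (hs : ∀ i, s i = 0) (x : B) :
    slopeForm p s x 1 = 1 - x ^ (p - 2) := by
  have h0 : ∀ i ∈ Finset.Icc 1 (p - 1), i ≠ 1 ∧ i ≠ p - 1 →
      (i : B) * sigCoeff p s i * x ^ (i - 1) * 1 ^ (p - 1 - i) = 0 := by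
    rintro i hi ⟨h1, h2⟩
    rw [Finset.mem_Icc] at hi
    have : i ∈ Finset.Ioo 1 (p - 1) := by rw [Finset.mem_Ioo]; omega
    simp [sigCoeff, this, hs]
  rw [slopeForm, Finset.sum_eq_add_of_mem 1 (p - 1) (by rw [Finset.mem_Icc]; omega)
    (by rw [Finset.mem_Icc]; omega) (by omega) h0, sigCoeff_one, sigCoeff_last,
    Nat.cast_sub (by omega), CharP.cast_eq_zero B p, show p - 1 - 1 = p - 2 by omega]
  simp
  ring

variable {p d : ℕ} {s : Finset.Ioo 1 (p - 1) → k} {a : Fin (d - p - 1) → k} {w : Fin 4 → k}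

/-- The part of the cusp polynomial coming from `L₁ ^ d`. -/
def pencilP (p d : ℕ) (a : Fin (d - p - 1) → k) (w : Fin 4 → k) : k[X] :=
  C (detW w) * linV (fun l => C (w l)) X 1 ^ (d - 1) *
    lineValDu p d (fun j => C (a j)) (fun l => C (w l)) X 1

/-- The part of the cusp polynomial coming from `σ`. -/
def pencilQ (p d : ℕ) (s : Finset.Ioo 1 (p - 1) → k) (a : Fin (d - p - 1) → k)
    (w : Fin 4 → k) : k[X] :=
  C (-scaleC p d w) * (slopeForm p (fun i => C (s i)) X 1 *
    lineVal p d (fun j => C (a j)) (fun l => C (w l)) X 1 ^ 2)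

theorem eval_pencilP (t : k) : (pencilP p d a w).eval t =
    detW w * linV w t 1 ^ (d - 1) * lineValDu p d a w t 1 := by
  rw [pencilP, ← coe_evalRingHom, map_mul, map_mul, map_pow, map_linV, map_lineValDu]; simp

theorem eval_slopeForm (t : k) : (slopeForm p (fun i => C (s i)) X 1).eval t =
    slopeForm p s t 1 := by
  rw [← coe_evalRingHom, map_slopeForm]; simp

theorem eval_lineVal (t : k) : (lineVal p d (fun j => C (a j)) (fun l => C (w l)) X 1).eval t =
    lineVal p d a w t 1 := by
  rw [← coe_evalRingHom, map_lineVal]; simp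

theorem eval_pencilQ (t : k) : (pencilQ p d s a w).eval t =
    -scaleC p d w * (slopeForm p s t 1 * lineVal p d a w t 1 ^ 2) := by
  rw [pencilQ, eval_mul, eval_mul, eval_C, eval_pow, eval_slopeForm, eval_lineVal]

theorem detW_smul {B : Type*} [CommRing B] (μ : B) (w : Fin 4 → B) :
    detW (fun l => μ * w l) = μ ^ 2 * detW w := by unfold detW; ring

theorem linU_smul_param {B : Type*} [CommRing B] (μ : B) (w : Fin 4 → B) (x y : B) :
    linU (fun l => μ * w l) x y = μ * linU w x y := by unfold linU; ring

theorem linV_smul_param {B : Type*} [CommRing B] (μ : B) (w : Fin 4 → B) (x y : B) :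
    linV (fun l => μ * w l) x y = μ * linV w x y := by unfold linV; ring

/-- For `d > p` the two summands are homogeneous in `w` of degrees `2d - p` and `2d`, so scaling `w`
changes their ratio by `μ ^ p`, which takes every value in an algebraically closed field. -/
theorem cuspForm_smul_param {B : Type*} [CommRing B] {p d : ℕ} (hp : 2 ≤ p) (hd : p ≤ d)
    (he : d - p ≠ 0) (s : Finset.Ioo 1 (p - 1) → B) (a : Fin (d - p - 1) → B) (w : Fin 4 → B)
    (μ x y : B) : cuspForm p d s a (fun l => μ * w l) x y =
      μ ^ (d + (d - p)) * (detW w * linV w x y ^ (d - 1) * lineValDu p d a w x y +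
        μ ^ p * (-scaleC p d w * (slopeForm p s x y * lineVal p d a w x y ^ 2))) := by
  have hsc : scaleC p d (fun l => μ * w l) = μ ^ (2 * p) * scaleC p d w := by
    rw [scaleC, detW_smul, mul_pow, ← pow_mul, scaleC]; ring
  have h1 : μ ^ 2 * (μ ^ (d - 1) * μ ^ (d - p - 1)) = μ ^ (d + (d - p)) := by
    rw [← pow_add, ← pow_add]; congr 1; omega
  have h2 : μ ^ (2 * p) * (μ ^ (d - p)) ^ 2 = μ ^ (d + (d - p)) * μ ^ p := by
    rw [← pow_mul, ← pow_add, ← pow_add]; congr 1; omega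
  rw [cuspForm, hsc, detW_smul, lineVal, lineValDu, linU_smul_param, linV_smul_param,
    tangentForm_smul, tangentFormDu_smul, ← lineVal, ← lineValDu, mul_pow, mul_pow]
  linear_combination (detW w * linV w x y ^ (d - 1) * lineValDu p d a w x y) * h1 -
    scaleC p d w * slopeForm p s x y * lineVal p d a w x y ^ 2 * h2

theorem cuspPoly_smul_param (hp : 2 ≤ p) (hd : p ≤ d) (he : d - p ≠ 0) (μ : k) :
    cuspPoly p d s a (fun l => μ * w l) =
      C (μ ^ (d + (d - p))) * (pencilP p d a w + C (μ ^ p) * pencilQ p d s a w) := by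
  have hdet : detW (fun l => (C (w l) : k[X])) = C (detW w) := (map_detW C w).symm
  have hsc : scaleC p d (fun l => (C (w l) : k[X])) = C (scaleC p d w) := (map_scaleC C p d w).symm
  have := cuspForm_smul_param hp hd he (fun i => C (s i)) (fun j => C (a j))
    (fun l => (C (w l) : k[X])) (C μ) X 1
  rw [cuspPoly]
  simp only [C_mul]
  rw [this, pencilP, pencilQ, hdet, hsc]
  simp

/-- The order of the Hasse derivative which detects multiple cusps. -/
def detectOrder (p : ℕ) : ℕ := if p = 2 then 2 else 1

/-- The polynomial in the parameters which vanishes where the number of cusps drops. -/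
def cuspDiscr {B : Type*} [CommRing B] (p d : ℕ) (s : Finset.Ioo 1 (p - 1) → B)
    (a : Fin (d - p - 1) → B) (w : Fin 4 → B) : B :=
  resultant (cuspPoly p d s a w) (hasseDeriv (detectOrder p) (cuspPoly p d s a w))
    (2 * d - p - 2) (2 * d - p - 2)

theorem hasseDeriv_map {B B' : Type*} [CommRing B] [CommRing B'] (f : B →+* B') (m : ℕ)
    (q : B[X]) : hasseDeriv m (q.map f) = (hasseDeriv m q).map f := by
  ext n; simp [hasseDeriv_coeff]

theorem map_cuspPoly {B B' : Type*} [CommRing B] [CommRing B'] (f : B →+* B') (p d : ℕ)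
    (s : Finset.Ioo 1 (p - 1) → B) (a : Fin (d - p - 1) → B) (w : Fin 4 → B) :
    (cuspPoly p d s a w).map f =
      cuspPoly p d (fun i => f (s i)) (fun j => f (a j)) (fun l => f (w l)) := by
  rw [cuspPoly, ← coe_mapRingHom, map_cuspForm]; simp [cuspPoly]

theorem map_cuspDiscr {B B' : Type*} [CommRing B] [CommRing B'] (f : B →+* B') (p d : ℕ)
    (s : Finset.Ioo 1 (p - 1) → B) (a : Fin (d - p - 1) → B) (w : Fin 4 → B) :
    f (cuspDiscr p d s a w) =
      cuspDiscr p d (fun i => f (s i)) (fun j => f (a j)) (fun l => f (w l)) := by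
  rw [cuspDiscr, cuspDiscr, ← map_cuspPoly, hasseDeriv_map, resultant_map_map]

theorem cuspDiscr_ne_zero_iff [IsAlgClosed k] [CharP k p] (hp : 2 ≤ p) (hd : p ≤ d)
    (hinf : cuspForm p d s a w 1 0 ≠ 0) : cuspDiscr p d s a w ≠ 0 ↔
      IsCoprime (cuspPoly p d s a w) (hasseDeriv (detectOrder p) (cuspPoly p d s a w)) := by
  have htop := hasTop_cuspPoly s a w hp hd
  have h2 := (natDegree_hasseDeriv_le (cuspPoly p d s a w) (detectOrder p)).trans
    ((Nat.sub_le _ _).trans htop.1)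
  rw [← htop.2] at hinf
  exact ⟨isCoprime_of_resultant_ne_zero htop.1 h2 hinf,
    resultant_ne_zero_of_isCoprime htop.1 h2 hinf⟩

theorem card_roots_cuspPoly [IsAlgClosed k] [DecidableEq k] [CharP k p] (hp : 2 ≤ p) (hd : p ≤ d)
    (hinf : cuspForm p d s a w 1 0 ≠ 0) (hdisc : cuspDiscr p d s a w ≠ 0) :
    (cuspPoly p d s a w).roots.toFinset.card = if p = 2 then d - 2 else 2 * d - p - 2 := by
  rw [cuspDiscr_ne_zero_iff hp hd hinf] at hdisc
  have htop := hasTop_cuspPoly s a w hp hd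
  have hdeg : (cuspPoly p d s a w).natDegree = 2 * d - p - 2 :=
    le_antisymm htop.1 (le_natDegree_of_ne_zero (by rwa [htop.2]))
  have hne : cuspPoly p d s a w ≠ 0 := fun h => hinf (by rw [← htop.2, h, coeff_zero])
  unfold detectOrder at hdisc
  split_ifs at hdisc ⊢ with h2
  · have := card_roots_of_isCoprime_hasseDeriv hne hdisc (derivative_cuspPoly h2 hd s a w)
    omega
  · rw [hasseDeriv_one'] at hdisc
    rw [card_roots_of_isCoprime_derivative hdisc, hdeg]

/-- For `d = p` the cusp polynomial is a nonzero multiple of `g`, which is `1` for `p = 2` and the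
separable polynomial `1 - X ^ (p - 2)` for `p > 2`. -/
theorem isCoprime_cuspPoly_of_eq [IsAlgClosed k] [CharP k p] (hp : p.Prime) (he : d - p = 0)
    (hs : ∀ i, s i = 0) (a : Fin (d - p - 1) → k) (hw : detW w ≠ 0) :
    IsCoprime (cuspPoly p d s a w) (hasseDeriv (detectOrder p) (cuspPoly p d s a w)) := by
  have hsc : scaleC p d (fun l => (C (w l) : k[X])) = C (scaleC p d w) := (map_scaleC C p d w).symm
  have hR : cuspPoly p d s a w =
      C (-scaleC p d w) * slopeForm p (fun i => C (s i)) X 1 := by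
    rw [cuspPoly, cuspForm, lineValDu_of_eq p d he, lineVal_of_eq p d he, hsc]
    simp
  have hc := neg_ne_zero.2 (scaleC_ne_zero p d hw)
  have hu : IsUnit (C (-scaleC p d w)) := isUnit_C.2 (isUnit_iff_ne_zero.2 hc)
  rw [hR, ← smul_eq_C_mul, map_smul, smul_eq_C_mul, smul_eq_C_mul,
    isCoprime_mul_unit_left hu]
  by_cases h2 : p = 2
  · rw [slopeForm_two h2]; exact isCoprime_one_left
  · have hp2 : 2 < p := lt_of_le_of_ne hp.two_le (Ne.symm h2)
    rw [slopeForm_of_forall_eq_zero hp2 (fun i => by rw [hs, C_0]), detectOrder, if_neg h2,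
      hasseDeriv_one']
    have hp0 : ((p - 2 : ℕ) : k) ≠ 0 := fun h => by
      have := Nat.le_of_dvd (by omega) ((CharP.cast_eq_zero_iff k p _).1 h)
      omega
    refine isCoprime_of_no_common_root (fun h => ?_) fun r hr hr' => ?_
    · have := congrArg (eval 0) h
      simp [show p - 2 ≠ 0 by omega] at this
    · simp [derivative_X_pow, hp0] at hr hr'
      rw [hr'.1] at hr
      simp [show p - 2 ≠ 0 by omega] at hr

theorem wronskian_ne_zero [CharP k p] (hp : p.Prime) (he : d - p ≠ 0)
    (hs : ∀ i, s i = 0) (ha : Function.Injective a) (ha0 : ∀ j, a j ≠ 0) (hw : detW w ≠ 0)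
    (hw2 : w 2 ≠ 0) (hPQ : ∀ r, (pencilQ p d s a w).eval r = 0 → (pencilP p d a w).eval r ≠ 0)
    (hM1 : lineVal p d a w 1 1 ≠ 0) :
    pencilP p d a w * hasseDeriv (detectOrder p) (pencilQ p d s a w) -
      hasseDeriv (detectOrder p) (pencilP p d a w) * pencilQ p d s a w ≠ 0 := by
  have hc := neg_ne_zero.2 (scaleC_ne_zero p d hw)
  -- At a root of `Q` only the first product survives, and `P ≠ 0` there. For `p = 2`, where `Q` is
  -- a multiple of `M ^ 2`, the root of `U` serves; for `p > 2` the simple root `1` of `1 - X ^ (p -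
  -- 2)` does.
  suffices ∃ r, (pencilQ p d s a w).eval r = 0 ∧
      (hasseDeriv (detectOrder p) (pencilQ p d s a w)).eval r ≠ 0 by
    obtain ⟨r, h0, h1⟩ := this
    intro h
    have := congrArg (eval r) h
    rw [eval_sub, eval_mul, eval_mul, h0, mul_zero, sub_zero, eval_zero] at this
    exact mul_ne_zero (hPQ r h0) h1 this
  by_cases h2 : p = 2
  · have hU : linU w (w 0 / w 2) 1 = 0 := by unfold linU; field_simp; ring
    have hM : lineVal p d a w (w 0 / w 2) 1 = 0 := by
      simp [lineVal, tangentForm, he, hU]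
    refine ⟨w 0 / w 2, by rw [eval_pencilQ, hM]; ring, ?_⟩
    rw [detectOrder, if_pos h2, pencilQ, slopeForm_two h2, one_mul, ← smul_eq_C_mul, map_smul,
      eval_smul, eval_hasseDeriv_two_sq (by rw [eval_lineVal, hM]), smul_eq_mul]
    refine mul_ne_zero hc (pow_ne_zero 2 ?_)
    have hder := derivation_tangentForm (derivative' (R := k)) (d - p)
      (fun j => (C (a j) : k[X]) ^ p) (fun j => derivation_pow_char _ _)
      (linU (fun l => C (w l)) X 1) (linV (fun l => C (w l)) X 1)
    change derivative (lineVal p d (fun j => C (a j)) (fun l => C (w l)) X 1) =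
      lineValDu p d (fun j => C (a j)) (fun l => C (w l)) X 1 *
        derivative (linU (fun l => C (w l)) X 1) +
      lineValDv p d (fun j => C (a j)) (fun l => C (w l)) X 1 *
        derivative (linV (fun l => C (w l)) X 1) at hder
    have hDu := lineValDu_ne_zero hp ha ha0 hw (Or.inr one_ne_zero) hM
    have hDv : lineValDv p d a w (w 0 / w 2) 1 = 0 := by
      simp [lineValDv, tangentFormDv, hU]
    rw [hder, ← coe_evalRingHom, map_add, map_mul, map_mul, map_lineValDu, map_lineValDv]
    simp [hDv, linU, hDu, hw2]
  · have hp2 : 2 < p := lt_of_le_of_ne hp.two_le (Ne.symm h2)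
    have hg : slopeForm p (fun i => (C (s i) : k[X])) X 1 = 1 - X ^ (p - 2) :=
      slopeForm_of_forall_eq_zero hp2 (fun i => by rw [hs, C_0]) X
    have hp0 : ((p - 2 : ℕ) : k) ≠ 0 := fun h => by
      have := Nat.le_of_dvd (by omega) ((CharP.cast_eq_zero_iff k p _).1 h)
      omega
    refine ⟨1, by rw [eval_pencilQ, slopeForm_of_forall_eq_zero hp2 hs]; simp, ?_⟩
    rw [detectOrder, if_neg h2, hasseDeriv_one', pencilQ, hg, derivative_C_mul, derivative_mul]
    simp [derivative_X_pow, eval_lineVal, hM1, hp0, scaleC_ne_zero p d hw]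

theorem exists_eval_ne_zero [Infinite k] {ι : Type*} {G : MvPolynomial ι k} (hG : G ≠ 0) :
    ∃ x, MvPolynomial.eval x G ≠ 0 := by
  by_contra! h
  exact hG (MvPolynomial.funext fun x => by rw [h, map_zero])

theorem isAdmissible_smul {μ : k} (hμ : μ ≠ 0) (hw : IsAdmissible p s w) :
    IsAdmissible p s (fun l => μ * w l) :=
  ⟨by rw [detW_smul]; exact mul_ne_zero (pow_ne_zero _ hμ) hw.1, mul_ne_zero hμ hw.2,
    mul_ne_zero hμ hw.3, by rw [slopeForm_smul]; exact mul_ne_zero (pow_ne_zero _ hμ) hw.4⟩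

theorem exists_maximal_cusps [IsAlgClosed k] [CharP k p] (hp : p.Prime) (hd : p ≤ d)
    {s : Finset.Ioo 1 (p - 1) → k} (hs : ∀ i, s i = 0) :
    ∃ (a : Fin (d - p - 1) → k) (w : Fin 4 → k), distinctPoly a ≠ 0 ∧ IsAdmissible p s w ∧
      cuspForm p d s a w 1 0 ≠ 0 ∧ cuspDiscr p d s a w ≠ 0 := by
  have : Infinite k := IsAlgClosed.instInfinite
  obtain ⟨a, hda⟩ := exists_eval_ne_zero (distinctPoly_X_ne_zero (k := k) (d - p - 1))
  rw [eval_distinctPoly] at hda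
  obtain ⟨ha, ha0⟩ := distinctPoly_ne_zero_iff.1 hda
  have hline : ∀ x y : k, x ≠ 0 ∨ y ≠ 0 →
      lineVal p d (fun j => (MvPolynomial.C (a j) : MvPolynomial (Fin 4) k)) MvPolynomial.X
        (MvPolynomial.C x) (MvPolynomial.C y) ≠ 0 := by
    intro x y hxy h
    by_cases hx : x = 0
    · have hy : y ≠ 0 := hxy.resolve_left (not_not.2 hx)
      have := congrArg (MvPolynomial.eval ![1, 0, 0, 0]) h
      rw [map_lineVal] at this
      simp [lineVal, linU, linV, tangentForm_zero_right, hy] at this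
    · have := congrArg (MvPolynomial.eval ![0, 0, 1, 0]) h
      rw [map_lineVal] at this
      simp [lineVal, linU, linV, tangentForm_zero_right, hx] at this
  obtain ⟨w, hw⟩ := exists_eval_ne_zero (mul_ne_zero (mul_ne_zero (mul_ne_zero
    (generalPoly_ne_zero (d := d) hp.two_le s ha0) (MvPolynomial.X_ne_zero 2))
    (hline 1 0 (Or.inl one_ne_zero))) (hline 1 1 (Or.inl one_ne_zero)))
  simp only [map_mul, mul_ne_zero_iff, MvPolynomial.eval_X, map_lineVal, MvPolynomial.eval_C,
    generalPoly, eval_admissiblePoly, ← isAdmissible_iff] at hw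
  obtain ⟨⟨⟨⟨hw, hgen⟩, hw2⟩, hM0⟩, hM1⟩ := hw
  by_cases he : d - p = 0
  · have hinf : cuspForm p d s a w 1 0 ≠ 0 := by
      rw [cuspForm, lineValDu_of_eq p d he, lineVal_of_eq p d he, slopeForm_one_zero hp.two_le]
      simpa using scaleC_ne_zero p d hw.1
    exact ⟨a, w, hda, hw, hinf, (cuspDiscr_ne_zero_iff hp.two_le hd hinf).2
      (isCoprime_cuspPoly_of_eq hp he hs a hw.1)⟩
  -- No base points: a common root of `P` and `Q` is a root of `R`, so `M ≠ 0` and `g = 0`. Then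
  -- `M_U ≠ 0` by the choice of `w`, so `V = 0`, contradicting `g(b₁, c₁) ≠ 0`.
  · have hPQ : ∀ r, (pencilQ p d s a w).eval r = 0 → (pencilP p d a w).eval r ≠ 0 := by
      intro r hQ hP
      have hc : cuspForm p d s a w r 1 = 0 := by
        rw [eval_pencilQ] at hQ
        rw [eval_pencilP] at hP
        rw [cuspForm]
        linear_combination hP + hQ
      have hM := lineVal_ne_zero_of_cuspForm hp ha ha0 hw.1 (Or.inr one_ne_zero) hc
      rw [eval_pencilQ] at hQ
      have hg : slopeForm p s r 1 = 0 := by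
        simpa [scaleC_ne_zero p d hw.1, hM] using hQ
      rw [if_neg he, map_prod, Finset.prod_ne_zero_iff] at hgen
      have hDu := hgen r ((mem_slopeRoots hp.two_le s r).2 hg)
      rw [map_lineValDu] at hDu
      rw [eval_pencilP] at hP
      have hV : linV w r 1 = 0 := by
        have hDu' : lineValDu p d a w r 1 ≠ 0 := by simpa using hDu
        have h := (mul_eq_zero.1 hP).resolve_right hDu'
        exact eq_zero_of_pow_eq_zero ((mul_eq_zero.1 h).resolve_left hw.1)
      have h1 : w 1 = w 3 * r := by unfold linV at hV; linear_combination -hV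
      have := slopeForm_smul p s (w 3) r 1
      rw [← h1, mul_one, hg, mul_zero] at this
      exact hw.4 this
    obtain ⟨S, hS⟩ := exists_finset_pencil (detectOrder p) hPQ
      (wronskian_ne_zero hp he hs ha ha0 hw.1 hw2 hPQ (by simpa using hM1))
    set P0 := detW w * linV w 1 0 ^ (d - 1) * lineValDu p d a w 1 0 with hP0
    set Q0 := -scaleC p d w * (slopeForm p s 1 0 * lineVal p d a w 1 0 ^ 2) with hQ0
    have hQ0' : Q0 ≠ 0 := by
      rw [hQ0, slopeForm_one_zero hp.two_le]
      simpa [scaleC_ne_zero p d hw.1] using hM0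
    classical
    -- Besides the bad members of the pencil, `0` is avoided to keep `μ ≠ 0`, and `-P0 / Q0` to keep
    -- the cusp form nonzero at `(1, 0)`.
    obtain ⟨l, hl⟩ := Infinite.exists_notMem_finset (insert 0 (insert (-P0 / Q0) S))
    simp only [Finset.mem_insert, not_or] at hl
    obtain ⟨hl0, hl1, hlS⟩ := hl
    obtain ⟨μ, rfl⟩ := IsAlgClosed.exists_pow_nat_eq l hp.pos
    have hμ : μ ≠ 0 := by rintro rfl; simp [hp.ne_zero] at hl0
    have hinf : cuspForm p d s a (fun l => μ * w l) 1 0 ≠ 0 := by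
      rw [cuspForm_smul_param hp.two_le hd he, ← hP0, ← hQ0]
      refine mul_ne_zero (pow_ne_zero _ hμ) fun h => hl1 ?_
      rw [eq_div_iff hQ0']
      linear_combination h
    refine ⟨a, fun l => μ * w l, hda, isAdmissible_smul hμ hw, hinf, ?_⟩
    rw [cuspDiscr_ne_zero_iff hp.two_le hd hinf]
    have hne : cuspPoly p d s a (fun l => μ * w l) ≠ 0 := fun h => hinf (by
      rw [← (hasTop_cuspPoly s a _ hp.two_le hd).2, h, coeff_zero])
    refine isCoprime_of_no_common_root hne fun r hr => ?_
    rw [cuspPoly_smul_param hp.two_le hd he, ← smul_eq_C_mul] at hr ⊢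
    rw [map_smul, eval_smul, smul_eq_mul]
    rw [eval_smul, smul_eq_mul] at hr
    exact mul_ne_zero (pow_ne_zero _ hμ)
      (hS _ hlS r ((mul_eq_zero.1 hr).resolve_left (pow_ne_zero _ hμ)))

/-- All conditions are written as one polynomial in the parameters jointly, formed over the
polynomial ring and then specialized. The member with maximal number of cusps shows that it is not
zero. -/
theorem general_cusps [IsAlgClosed k] (p : ℕ) (hp : p.Prime) [CharP k p] (d : ℕ) (hd : p ≤ d) :
    ForGeneral₃ fun (s : Finset.Ioo 1 (p - 1) → k) (a : Fin (d - p - 1) → k) (w : Fin 4 → k) =>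
      (p = 2 → {P | IsCusp (fiberEq p d s a w) P}.encard = (d - 2 : ℕ)) ∧
      (2 < p → {P | IsCusp (fiberEq p d s a w) P}.encard = (2 * d - p - 2 : ℕ)) := by
  classical
  set A := MvPolynomial (Finset.Ioo 1 (p - 1) ⊕ Fin (d - p - 1) ⊕ Fin 4) k
  set s' : Finset.Ioo 1 (p - 1) → A := fun i => MvPolynomial.X (.inl i)
  set a' : Fin (d - p - 1) → A := fun j => MvPolynomial.X (.inr (.inl j))
  set w' : Fin 4 → A := fun l => MvPolynomial.X (.inr (.inr l))
  set G : A := distinctPoly a' * admissiblePoly p s' w' * cuspForm p d s' a' w' 1 0 *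
    cuspDiscr p d s' a' w' with hG
  have hev : ∀ (s : Finset.Ioo 1 (p - 1) → k) (a : Fin (d - p - 1) → k) (w : Fin 4 → k),
      MvPolynomial.eval (Sum.elim s (Sum.elim a w)) G =
        distinctPoly a * admissiblePoly p s w * cuspForm p d s a w 1 0 *
          cuspDiscr p d s a w := fun s a w => by
    rw [hG, map_mul, map_mul, map_mul, map_cuspForm, map_cuspDiscr, admissiblePoly, map_mul,
      map_slopeForm, map_mul, map_mul, map_detW]
    simp [distinctPoly, map_prod, s', a', w', admissiblePoly]
  refine ⟨G, fun h0 => ?_, fun v hv => ?_⟩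
  · obtain ⟨a, w, h1, h2, h3, h4⟩ := exists_maximal_cusps (k := k) hp hd (s := fun _ => 0)
      fun _ => rfl
    have := hev (fun _ => 0) a w
    rw [h0, map_zero] at this
    exact mul_ne_zero (mul_ne_zero (mul_ne_zero h1 (isAdmissible_iff.1 h2)) h3) h4 this.symm
  · have hv' : v = Sum.elim (fun i => v (.inl i)) (Sum.elim (fun j => v (.inr (.inl j)))
        (fun l => v (.inr (.inr l)))) := by
      ext (i | j | l) <;> rfl
    rw [hv', hev] at hv
    simp only [mul_ne_zero_iff, ← isAdmissible_iff, distinctPoly_ne_zero_iff] at hv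
    obtain ⟨⟨⟨⟨ha, ha0⟩, hw⟩, hinf⟩, hdisc⟩ := hv
    have hne : cuspPoly p d _ _ _ ≠ 0 := fun h => hinf (by
      rw [← (hasTop_cuspPoly _ _ _ hp.two_le hd).2, h, coeff_zero])
    have hcount := encard_isCusp hp hd ha ha0 hw hinf hne
    rw [card_roots_cuspPoly hp.two_le hd hinf hdisc] at hcount
    refine ⟨fun h2 => ?_, fun h2 => ?_⟩
    · rw [hcount, if_pos h2]
    · rw [hcount, if_neg (by omega)]

end Pencil

end A1Curves

end

theorem theorem1p6 {k : Type*} [Field k] [IsAlgClosed k] (p : ℕ) (hp : p.Prime) [CharP k p]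
    (d : ℕ) (hd : p ≤ d) :
    (∀ s : Finset.Ioo 1 (p - 1) → k,
      A1Curves.ForGeneral fun a : Fin (d - p - 1) → k =>
      A1Curves.ForGeneral fun w : Fin 4 → k =>
        A1Curves.IsOrdinaryPoint (A1Curves.fiberEq p d s a w) A1Curves.str (d - p) ∧
        (∀ P, A1Curves.IsSingularPoint (A1Curves.fiberEq p d s a w) P → P ≠ A1Curves.str →
          A1Curves.IsCusp (A1Curves.fiberEq p d s a w) P) ∧
        (d - p = 0 → ∀ P, A1Curves.OnCurve (A1Curves.fiberEq p d s a w) P →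
          (¬ A1Curves.TotalSmoothAt p d s a P w ↔
            A1Curves.IsCusp (A1Curves.fiberEq p d s a w) P)) ∧
        (d - p = 1 → ∀ P, A1Curves.OnCurve (A1Curves.fiberEq p d s a w) P →
          A1Curves.TotalSmoothAt p d s a P w) ∧
        (1 < d - p → ∀ P, A1Curves.OnCurve (A1Curves.fiberEq p d s a w) P → P ≠ A1Curves.str →
          A1Curves.TotalSmoothAt p d s a P w)) ∧
    (A1Curves.ForGeneral₃ fun (s : Finset.Ioo 1 (p - 1) → k) (a : Fin (d - p - 1) → k)
        (w : Fin 4 → k) =>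
      (p = 2 → {P | A1Curves.IsCusp (A1Curves.fiberEq p d s a w) P}.encard = (d - 2 : ℕ)) ∧
      (2 < p → {P | A1Curves.IsCusp (A1Curves.fiberEq p d s a w) P}.encard =
        (2 * d - p - 2 : ℕ))) :=
  ⟨A1Curves.general_fiber p hp d hd, A1Curves.general_cusps p hp d hd⟩
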